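/- Let $m\ge 1$, $d_1,\dots,d_m\ge 1$, $d=d_1+\dots+d_m$, and write $x=(x_1,\dots,x_m)\in\mathbb R^{d_1}\times\dots\times\mathbb R^{d_m}=\mathbb R^d$. For $j=1,\dots,m$ let $\tilde E_j\in\mathbb R^{d_j\times d_j}$ be a matrix all of whose eigenvalues have positive real part; let $a_1^j$ and $a_{p_j}^j$ be the smallest and the largest real part of an eigenvalue of $\tilde E_j$, and $q_j=\operatorname{trace}(\tilde E_j)$. Let $\psi_j:\mathbb R^{d_j}\to[0,\infty)$ be continuous, with $\psi_j(\xi)\ne0$ for $\xi\neq 0$ and $\psi_j(c^{\tilde E_j^T}\xi)=c\,\psi_j(\xi)$ for all $c>0$, where $c^{A}=\exp((\log c)A)$. Let $0<\alpha\le 2$ and $0<H_j<a_1^j$ for all $j$, and let the blocks be numbered so that $\min_{j} H_j/a_{p_j}^j=H_1/a_{p_1}^1$. Let $W_\alpha$ be a complex isotropic symmetric $\alpha$-stable random measure on $\mathbb R^d$ with Lebesgue control measure, that is, for some normalization constant $\kappa>0$ the stochastic integrals $\int f\,dW_\alpha$ satisfy $$\mathbb E\exp\Big(i\operatorname{Re}\sum_{k}\overline{\theta_k}\int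 f_k\,dW_\alpha\Big)=\exp\Big(-\kappa\int_{\mathbb R^d}\Big|\sum_k\overline{\theta_k}f_k(\xi)\Big|^\alpha d\xi\Big)$$ for all finite families $f_k\in L^\alpha(\mathbb R^d;\mathbb C)$ and $\theta_k\in\mathbb C$. Put $$X_\alpha(x)=\operatorname{Re}\int_{\mathbb R^d}\prod_{j=1}^m\big(e^{i\langle x_j,\xi_j\rangle}-1\big)\psi_j(\xi_j)^{-H_j-q_j/\alpha}\,W_\alpha(d\xi),\qquad x\in\mathbb R^d,$$ and let $\sigma(x,y)=\|X_\alpha(x)-X_\alpha(y)\|_\alpha$ be the scale parameter of the symmetric $\alpha$-stable random variable $X_\alpha(x)-X_\alpha(y)$, i.e. the number $\sigma\ge 0$ with $\mathbb E\,e^{it(X_\alpha(x)-X_\alpha(y))}=e^{-\sigma^\alpha|t|^\alpha}$ for all $t\in\mathbb R$. Let $\|\cdot\|$ be any norm on $\mathbb R^d$, let $Q=[\frac12,1]^d$, and for $l=0,1,2,\dots$ let $$W_l=\{(x,y)\in Q\times Q:\ x_1\ne y_1,\ 2^{-l-1}\le\|x-y\|\le 2^{-l}\}.$$ Then, for all sufficiently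 small $\varepsilon>0$ and all $\gamma\in\big(1,\,d+1-\frac{H_1}{a_{p_1}^1}-\varepsilon\big)$, $$\sum_{l=0}^\infty 2^{l(\gamma-1)}\int_{W_l}\sigma^{-1}(x,y)\,dx\,dy<\infty .$$ -/

import Mathlib

open MeasureTheory

noncomputable section

namespace StableSheet

/-- The space `ℝ^d = ℝ^{d_1} × ⋯ × ℝ^{d_m}`, `d = d_1 + ⋯ + d_m`. A point `x` has the blocks `x j`.
Only its vector space structure, its Borel sets and its Lebesgue measure `volume` are used;
the norm on it is a separate datum of the theorem. -/
abbrev Space {m : ℕ} (d : Fin m → ℕ) : Type := (j : Fin m) → Fin (d j) → ℝ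

/-- The matrix power `c ^ A = exp (log c • A)`, for `c > 0`. -/
def matPow {n : ℕ} (c : ℝ) (A : Matrix (Fin n) (Fin n) ℝ) : Matrix (Fin n) (Fin n) ℝ :=
  NormedSpace.exp (Real.log c • A)

/-- The set of real parts of the (complex) eigenvalues of a real square matrix. -/
def eigRe {n : ℕ} (A : Matrix (Fin n) (Fin n) ℝ) : Set ℝ :=
  Complex.re '' spectrum ℂ (A.map (fun r : ℝ => (r : ℂ)))

/-- The smallest real part of an eigenvalue (the set is finite, and non-empty for `0 < n`). -/
def minRe {n : ℕ} (A : Matrix (Fin n) (Fin n) ℝ) : ℝ := sInf (eigRe A)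

/-- The largest real part of an eigenvalue. -/
def maxRe {n : ℕ} (A : Matrix (Fin n) (Fin n) ℝ) : ℝ := sSup (eigRe A)

/-- `ψ : ℝⁿ → [0, ∞)` is continuous, `A`-homogeneous (`ψ (c ^ A x) = c ψ x` for all `c > 0`), and
does not vanish away from the origin. -/
structure IsHomogeneous {n : ℕ} (A : Matrix (Fin n) (Fin n) ℝ) (ψ : (Fin n → ℝ) → ℝ) : Prop where
  continuous : Continuous ψ
  nonneg : ∀ x, 0 ≤ ψ x
  ne_zero : ∀ x, x ≠ 0 → ψ x ≠ 0
  homogeneous : ∀ c : ℝ, 0 < c → ∀ x, ψ ((matPow c A).mulVec x) = c * ψ x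

/-- The integrand
`ξ ↦ ∏ j, (exp (i ⟨x_j, ξ_j⟩) - 1) ψ_j (ξ_j) ^ (-H_j - q_j / α)` with `q_j = trace E_j`. -/
def kernel {m : ℕ} {d : Fin m → ℕ} (α : ℝ) (E : (j : Fin m) → Matrix (Fin (d j)) (Fin (d j)) ℝ)
    (H : Fin m → ℝ) (ψ : (j : Fin m) → (Fin (d j) → ℝ) → ℝ) (x ξ : Space d) : ℂ :=
  ∏ j, (Complex.exp (Complex.I * ((x j ⬝ᵥ ξ j : ℝ) : ℂ)) - 1) *
    ((ψ j (ξ j) ^ (-H j - (E j).trace / α) : ℝ) : ℂ)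

/-- `W f = ∫ f dW_α` is the stochastic integral against a complex isotropic symmetric `α`-stable
random measure on `S` with control measure `ν`. As usual it is given as a complex valued
stochastic process indexed by the functions `f ∈ L^α(ν)`, through its finite-dimensional
distributions: with `Re (conj θ z)` as the real inner product of `ℂ = ℝ²`,
`E exp (i Re ∑ₖ conj θₖ W fₖ) = exp (- κ ∫ |∑ₖ conj θₖ fₖ| ^ α dν)`.
(The random measure itself is `A ↦ W 1_A`.) The constant `κ > 0` is the normalization of the
random measure, on which conventions differ. -/
structure IsIsotropicStableIntegral {S Ω : Type*} [MeasurableSpace S] [MeasurableSpace Ω]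
    (α κ : ℝ) (ν : Measure S) (P : Measure Ω) (W : (S → ℂ) → Ω → ℂ) : Prop where
  measurable : ∀ f, MemLp f (ENNReal.ofReal α) ν → Measurable (W f)
  charFun_eq : ∀ (n : ℕ) (f : Fin n → S → ℂ) (θ : Fin n → ℂ),
    (∀ k, MemLp (f k) (ENNReal.ofReal α) ν) →
    ∫ ω, Complex.exp
        (Complex.I * (((∑ k, starRingEnd ℂ (θ k) * W (f k) ω).re : ℝ) : ℂ)) ∂P =
      ((Real.exp (-(κ * ∫ s, ‖∑ k, starRingEnd ℂ (θ k) * f k s‖ ^ α ∂ν)) : ℝ) : ℂ)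

/-- The harmonizable operator scaling stable random sheet `X_α (x) = Re ∫ kernel x dW_α`. -/
def sheet {m : ℕ} {d : Fin m → ℕ} {Ω : Type*} (α : ℝ)
    (E : (j : Fin m) → Matrix (Fin (d j)) (Fin (d j)) ℝ)
    (H : Fin m → ℝ) (ψ : (j : Fin m) → (Fin (d j) → ℝ) → ℝ)
    (W : (Space d → ℂ) → Ω → ℂ) (x : Space d) (ω : Ω) : ℝ :=
  (W (kernel α E H ψ x) ω).re

/-- The scale parameter `‖Y‖_α` of a symmetric `α`-stable random variable `Y`: the (unique) `s ≥ 0`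
with `E exp (i t Y) = exp (- s ^ α |t| ^ α)` for all real `t`. -/
def scale {Ω : Type*} [MeasurableSpace Ω] (α : ℝ) (P : Measure Ω) (Y : Ω → ℝ) : ℝ :=
  sInf {s : ℝ | 0 ≤ s ∧ ∀ t : ℝ, ∫ ω, Complex.exp (Complex.I * ((t * Y ω : ℝ) : ℂ)) ∂P =
    ((Real.exp (-(s ^ α * |t| ^ α)) : ℝ) : ℂ)}

/-- `σ (x, y) = ‖X_α (x) - X_α (y)‖_α`. -/
def sigma {m : ℕ} {d : Fin m → ℕ} {Ω : Type*} [MeasurableSpace Ω] (α : ℝ)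
    (E : (j : Fin m) → Matrix (Fin (d j)) (Fin (d j)) ℝ)
    (H : Fin m → ℝ) (ψ : (j : Fin m) → (Fin (d j) → ℝ) → ℝ)
    (P : Measure Ω) (W : (Space d → ℂ) → Ω → ℂ) (x y : Space d) : ℝ :=
  scale α P (fun ω => sheet α E H ψ W x ω - sheet α E H ψ W y ω)

/-- The cube `Q = [1/2, 1]^d`. -/
def cube {m : ℕ} (d : Fin m → ℕ) : Set (Space d) :=
  {x | ∀ j i, 1 / 2 ≤ x j i ∧ x j i ≤ 1}

/-- `W_l = {(x, y) ∈ Q × Q : x_1 ≠ y_1, 2^{-l-1} ≤ ‖x - y‖ ≤ 2^{-l}}` for the norm `N`. The first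
block has the index `0`. -/
def dyadicShell {m : ℕ} [NeZero m] {d : Fin m → ℕ} (N : Seminorm ℝ (Space d)) (l : ℕ) :
    Set (Space d × Space d) :=
  {p | p.1 ∈ cube d ∧ p.2 ∈ cube d ∧ p.1 0 ≠ p.2 0 ∧
    (2 : ℝ) ^ (-(l : ℝ) - 1) ≤ N (p.1 - p.2) ∧ N (p.1 - p.2) ≤ (2 : ℝ) ^ (-(l : ℝ))}

end StableSheet

end

noncomputable section

namespace StableSheet

open NormedSpace Matrix Set

section MatrixExponential

open scoped Nat

variable {n : ℕ}

open scoped Matrix.Norms.Operator in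
theorem hasSum_exp_matrix {𝕜 : Type*} [RCLike 𝕜] (A : Matrix (Fin n) (Fin n) 𝕜) :
    HasSum (fun k : ℕ => ((k ! : 𝕜)⁻¹) • A ^ k) (exp A) :=
  exp_series_hasSum_exp' (𝕂 := 𝕜) A

open scoped Matrix.Norms.Operator in
theorem hasDerivAt_exp_smul_apply (A : Matrix (Fin n) (Fin n) ℝ) (t : ℝ) (i j : Fin n) :
    HasDerivAt (fun t : ℝ => exp (t • A) i j) ((exp (t • A) * A) i j) t := by
  have h : HasDerivAt (fun t : ℝ => exp (t • A)) (exp (t • A) * A) t :=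
    hasDerivAt_exp_smul_const A t
  let L : Matrix (Fin n) (Fin n) ℝ →ₗ[ℝ] ℝ := Matrix.entryLinearMap ℝ ℝ i j
  exact (L.toContinuousLinearMap.hasFDerivAt (x := exp (t • A))).comp_hasDerivAt t h

theorem exp_add_smul {𝕜 : Type*} [RCLike 𝕜] (A : Matrix (Fin n) (Fin n) 𝕜) (s t : 𝕜) :
    exp ((s + t) • A) = exp (s • A) * exp (t • A) := by
  rw [add_smul]
  exact Matrix.exp_add_of_commute _ _ (((Commute.refl A).smul_left s).smul_right t)

theorem exp_smul_mul_exp_neg_smul (A : Matrix (Fin n) (Fin n) ℝ) (t : ℝ) :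
    exp (t • A) * exp ((-t) • A) = 1 := by
  rw [← exp_add_smul, add_neg_cancel, zero_smul, NormedSpace.exp_zero]

theorem exp_neg_smul_mulVec_exp_smul (A : Matrix (Fin n) (Fin n) ℝ) (t : ℝ) (x : Fin n → ℝ) :
    exp ((-t) • A) *ᵥ (exp (t • A) *ᵥ x) = x := by
  rw [mulVec_mulVec]
  have := exp_smul_mul_exp_neg_smul A (-t)
  rw [neg_neg] at this
  rw [this, one_mulVec]

open scoped Matrix.Norms.Operator in
theorem exp_map_ofReal (A : Matrix (Fin n) (Fin n) ℝ) :
    (exp A).map (fun r : ℝ => (r : ℂ)) = exp (A.map (fun r : ℝ => (r : ℂ))) := by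
  have h := NormedSpace.map_exp (Complex.ofRealHom.mapMatrix (m := Fin n)) (by
    exact Continuous.matrix_map continuous_id Complex.continuous_ofReal) A
  exact h

/-- `det (exp (t A)) = exp (t tr A)`. -/
theorem det_exp_smul (A : Matrix (Fin n) (Fin n) ℝ) (t : ℝ) :
    (exp (t • A)).det = Real.exp (t * A.trace) := by
  set f : ℝ → ℝ := fun t => (exp (t • A)).det with hf
  have hdet : Differentiable ℝ (fun B : Fin n → Fin n → ℝ => (Matrix.of B).det) := by
    simp only [Matrix.det_apply, Matrix.of_apply]
    fun_prop
  have hentry : ∀ t, HasDerivAt (fun t : ℝ => fun i j => exp (t • A) i j)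
      (fun i j => (exp (t • A) * A) i j) t := fun t =>
    hasDerivAt_pi.2 fun i => hasDerivAt_pi.2 fun j => hasDerivAt_exp_smul_apply A t i j
  set D := fderiv ℝ (fun B : Fin n → Fin n → ℝ => (Matrix.of B).det)
    (fun i j => (1 : Matrix (Fin n) (Fin n) ℝ) i j) with hD
  have h1 : HasDerivAt f (D (fun i j => A i j)) 0 := by
    have h := hentry 0
    simp only [zero_smul, NormedSpace.exp_zero, one_mul] at h
    refine HasFDerivAt.comp_hasDerivAt (f := fun t : ℝ => fun i j => exp (t • A) i j) 0 ?_ h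
    simp only [zero_smul, NormedSpace.exp_zero]
    exact (hdet _).hasFDerivAt
  have h2 : HasDerivAt (fun t : ℝ => (1 + t • A).det) (D (fun i j => A i j)) 0 := by
    have h : HasDerivAt (fun t : ℝ => fun i j => (1 + t • A) i j) (fun i j => A i j) 0 := by
      refine hasDerivAt_pi.2 fun i => hasDerivAt_pi.2 fun j => ?_
      simpa using ((hasDerivAt_id (0 : ℝ)).mul_const (A i j)).const_add
        ((1 : Matrix (Fin n) (Fin n) ℝ) i j)
    refine HasFDerivAt.comp_hasDerivAt (f := fun t : ℝ => fun i j => (1 + t • A) i j) 0 ?_ h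
    simp only [zero_smul, add_zero]
    exact (hdet _).hasFDerivAt
  have h3 : HasDerivAt (fun t : ℝ => (1 + t • A).det) A.trace 0 := by
    obtain ⟨p, hp⟩ : ∃ p : Polynomial ℝ, ∀ t : ℝ,
        (1 + t • A).det = 1 + A.trace * t + p.eval t * t ^ 2 :=
      ⟨_, fun t => Matrix.det_one_add_smul t A⟩
    rw [funext hp]
    have e := (((hasDerivAt_id (0 : ℝ)).const_mul A.trace).const_add 1).add
      ((p.hasDerivAt 0).mul ((hasDerivAt_id (0 : ℝ)).pow 2))
    refine HasDerivAt.congr_deriv (e.congr_of_eventuallyEq ?_) ?_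
    · exact Filter.Eventually.of_forall fun t => by simp
    · simp
  rw [h2.unique h3] at h1
  have hadd : ∀ s t, f (s + t) = f s * f t := fun s t => by
    simp only [hf, exp_add_smul, Matrix.det_mul]
  have h4 : ∀ s, HasDerivAt f (f s * A.trace) s := by
    intro s
    have h : HasDerivAt (fun u => f s * f (u - s)) (f s * A.trace) s := by
      refine HasDerivAt.const_mul _ ?_
      have := HasDerivAt.comp_sub_const s s (f := f) (f' := A.trace) (by simpa using h1)
      exact this
    refine h.congr_of_eventuallyEq (Filter.Eventually.of_forall fun u => ?_)
    change f u = f s * f (u - s)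
    rw [← hadd]; congr 1; ring
  have h5 : ∀ s, HasDerivAt (fun s => f s * Real.exp (-(s * A.trace))) 0 s := by
    intro s
    have := (h4 s).mul (((hasDerivAt_id s).mul_const A.trace).neg.exp)
    refine this.congr_deriv ?_
    simp only [id, one_mul]; ring
  have h6 := is_const_of_deriv_eq_zero (fun s => (h5 s).differentiableAt)
    (fun s => (h5 s).deriv) t 0
  simp only [zero_mul, neg_zero, Real.exp_zero, mul_one] at h6
  have h7 : f 0 = 1 := by simp [hf]
  rw [h7, Real.exp_neg] at h6
  field_simp at h6
  exact h6

/-- On a vector killed by a power of `N`, the exponential series of `N` is a finite sum. -/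
theorem exp_mulVec_of_pow_mulVec_eq_zero (N : Matrix (Fin n) (Fin n) ℂ) (v : Fin n → ℂ) (k : ℕ)
    (h : N ^ k *ᵥ v = 0) :
    exp N *ᵥ v = ∑ i ∈ Finset.range k, ((i ! : ℂ)⁻¹) • (N ^ i *ᵥ v) := by
  have hc : Continuous (fun B : Matrix (Fin n) (Fin n) ℂ => B *ᵥ v) := by fun_prop
  let L : Matrix (Fin n) (Fin n) ℂ →+ (Fin n → ℂ) :=
    { toFun := fun B => B *ᵥ v, map_zero' := by simp, map_add' := fun B C => add_mulVec B C v }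
  have h1 : HasSum (fun i => ((i ! : ℂ)⁻¹) • (N ^ i *ᵥ v)) (exp N *ᵥ v) := by
    have := (hasSum_exp_matrix N).map L hc
    have e : (fun i => ((i ! : ℂ)⁻¹) • (N ^ i *ᵥ v)) = L ∘ fun i => ((i ! : ℂ)⁻¹) • N ^ i := by
      funext i
      simp [L, smul_mulVec]
    rw [e]
    exact this
  refine h1.unique (hasSum_sum_of_ne_finset_zero fun i hi => ?_)
  rw [Finset.mem_range, not_lt] at hi
  rw [← Nat.sub_add_cancel hi, pow_add, ← mulVec_mulVec, h, mulVec_zero, smul_zero]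

theorem exp_smul_mulVec_of_pow_sub_mulVec_eq_zero (M : Matrix (Fin n) (Fin n) ℂ) (μ : ℂ)
    (v : Fin n → ℂ) (k : ℕ) (h : (M - μ • (1 : Matrix (Fin n) (Fin n) ℂ)) ^ k *ᵥ v = 0) (t : ℂ) :
    exp (t • M) *ᵥ v = Complex.exp (t * μ) • ∑ i ∈ Finset.range k,
      ((t ^ i / (i ! : ℂ))) • ((M - μ • (1 : Matrix (Fin n) (Fin n) ℂ)) ^ i *ᵥ v) := by
  set N := M - μ • (1 : Matrix (Fin n) (Fin n) ℂ) with hN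
  have e1 : t • M = (t * μ) • (1 : Matrix (Fin n) (Fin n) ℂ) + t • N := by
    rw [hN, smul_sub, smul_smul]; abel
  have e2 : exp ((t * μ) • (1 : Matrix (Fin n) (Fin n) ℂ)) =
      Complex.exp (t * μ) • (1 : Matrix (Fin n) (Fin n) ℂ) := by
    rw [smul_one_eq_diagonal, smul_one_eq_diagonal, Matrix.exp_diagonal]
    congr 1
    funext i
    rw [Pi.coe_exp, Complex.exp_eq_exp_ℂ]
  rw [e1, Matrix.exp_add_of_commute _ _ ((Commute.one_left _).smul_left _), e2, smul_mul_assoc,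
    one_mul, smul_mulVec]
  congr 1
  rw [exp_mulVec_of_pow_mulVec_eq_zero (t • N) v k (by rw [smul_pow, smul_mulVec, h, smul_zero])]
  refine Finset.sum_congr rfl fun i _ => ?_
  rw [smul_pow, smul_mulVec, smul_smul, div_eq_inv_mul]

end MatrixExponential

section Decay

open scoped Nat

variable {n : ℕ}

theorem pow_mul_exp_le {δ t : ℝ} (hδ : 0 < δ) (ht : 0 ≤ t) (i : ℕ) :
    t ^ i / i ! * Real.exp (-(δ * t)) ≤ (δ ^ i)⁻¹ := by
  have h := Real.pow_div_factorial_le_exp (δ * t) (by positivity) i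
  rw [mul_pow, mul_div_assoc] at h
  have hd : 0 < δ ^ i := by positivity
  rw [Real.exp_neg, ← div_eq_mul_inv, div_le_iff₀ (Real.exp_pos _), inv_mul_eq_div, le_div_iff₀ hd]
  linarith

theorem exists_norm_exp_smul_mulVec_le_complex (M : Matrix (Fin n) (Fin n) ℂ) {a : ℝ}
    (ha : ∀ μ ∈ spectrum ℂ M, a < μ.re) (v : Fin n → ℂ) :
    ∃ C : ℝ, ∀ t : ℝ, t ≤ 0 → ‖exp ((t : ℂ) • M) *ᵥ v‖ ≤ C * Real.exp (a * t) := by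
  have hv : v ∈ ⨆ μ : ℂ, Module.End.maxGenEigenspace (Matrix.toLin' M) μ := by
    rw [Module.End.iSup_maxGenEigenspace_eq_top]; trivial
  refine Submodule.iSup_induction _ (motive := fun v => ∃ C : ℝ, ∀ t : ℝ, t ≤ 0 →
    ‖exp ((t : ℂ) • M) *ᵥ v‖ ≤ C * Real.exp (a * t)) hv ?_ ⟨0, by simp⟩ ?_
  · intro μ v hv
    obtain ⟨k, hk⟩ := Module.End.mem_maxGenEigenspace _ _ _ |>.1 hv
    set N := M - μ • (1 : Matrix (Fin n) (Fin n) ℂ) with hN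
    have hk' : N ^ k *ᵥ v = 0 := by
      have : (Matrix.toLin' M - μ • (1 : Module.End ℂ (Fin n → ℂ))) = Matrix.toLin' N := by
        rw [hN, map_sub, map_smul, Matrix.toLin'_one]; rfl
      rwa [this, ← Matrix.toLin'_pow, Matrix.toLin'_apply] at hk
    by_cases hμ : μ ∈ spectrum ℂ M
    · have hδ : 0 < μ.re - a := sub_pos.2 (ha μ hμ)
      refine ⟨∑ i ∈ Finset.range k, ((μ.re - a) ^ i)⁻¹ * ‖N ^ i *ᵥ v‖, fun t ht => ?_⟩
      rw [exp_smul_mulVec_of_pow_sub_mulVec_eq_zero M μ v k hk', ← hN, norm_smul,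
        Complex.norm_exp]
      have hre : ((t : ℂ) * μ).re = a * t + -((μ.re - a) * -t) := by
        simp; ring
      rw [hre, Real.exp_add, mul_assoc, mul_comm]
      refine mul_le_mul_of_nonneg_right ?_ (Real.exp_pos _).le
      refine (mul_le_mul_of_nonneg_left (norm_sum_le _ _) (Real.exp_pos _).le).trans ?_
      rw [Finset.mul_sum]
      refine Finset.sum_le_sum fun i _ => ?_
      rw [norm_smul, ← mul_assoc]
      refine mul_le_mul_of_nonneg_right ?_ (norm_nonneg _)
      have := pow_mul_exp_le hδ (neg_nonneg.2 ht) i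
      have hn : ‖(t : ℂ) ^ i / (i ! : ℂ)‖ = (-t) ^ i / i ! := by
        rw [norm_div, norm_pow, Complex.norm_real, Complex.norm_natCast, Real.norm_eq_abs,
          abs_of_nonpos ht]
      rwa [hn, mul_comm]
    · have hu : IsUnit N := by
        have h := spectrum.notMem_iff.1 hμ
        rw [Algebra.algebraMap_eq_smul_one] at h
        rw [hN, ← neg_sub]
        exact h.neg
      have hv0 : v = 0 := by
        obtain ⟨U, hU⟩ := (hu.pow k)
        have : ((U⁻¹ : (Matrix (Fin n) (Fin n) ℂ)ˣ) : Matrix (Fin n) (Fin n) ℂ) *ᵥ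
          (N ^ k *ᵥ v) = v := by
          rw [mulVec_mulVec, ← hU, Units.inv_mul, one_mulVec]
        rw [← this, hk', mulVec_zero]
      exact ⟨0, fun t _ => by simp [hv0]⟩
  · rintro v w ⟨C, hC⟩ ⟨D, hD⟩
    refine ⟨C + D, fun t ht => ?_⟩
    rw [mulVec_add, add_mul]
    exact (norm_add_le _ _).trans (add_le_add (hC t ht) (hD t ht))

theorem mulVec_map_ofReal (A : Matrix (Fin n) (Fin n) ℝ) (x : Fin n → ℝ) :
    A.map (fun r : ℝ => (r : ℂ)) *ᵥ (fun i => (x i : ℂ)) = fun i => ((A *ᵥ x) i : ℂ) := by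
  funext i
  simp [mulVec, dotProduct]

theorem exp_smul_map_ofReal (A : Matrix (Fin n) (Fin n) ℝ) (t : ℝ) :
    exp ((t : ℂ) • A.map (fun r : ℝ => (r : ℂ))) = (exp (t • A)).map (fun r : ℝ => (r : ℂ)) := by
  rw [exp_map_ofReal]
  congr 1
  ext i j
  simp

theorem exists_norm_exp_smul_mulVec_le (A : Matrix (Fin n) (Fin n) ℝ) {a : ℝ}
    (ha : ∀ r ∈ eigRe A, a < r) :
    ∃ C : ℝ, 0 ≤ C ∧ ∀ t : ℝ, t ≤ 0 → ∀ x : Fin n → ℝ,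
      ‖exp (t • A) *ᵥ x‖ ≤ C * Real.exp (a * t) * ‖x‖ := by
  have hb : ∀ x : Fin n → ℝ, ∃ C : ℝ, ∀ t : ℝ, t ≤ 0 →
      ‖exp (t • A) *ᵥ x‖ ≤ C * Real.exp (a * t) := by
    intro x
    obtain ⟨C, hC⟩ := exists_norm_exp_smul_mulVec_le_complex
      (A.map (fun r : ℝ => (r : ℂ))) (fun μ hμ => ha _ ⟨μ, hμ, rfl⟩) (fun i => (x i : ℂ))
    refine ⟨C, fun t ht => ?_⟩
    have h := hC t ht
    rw [exp_smul_map_ofReal, mulVec_map_ofReal] at h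
    refine (le_of_eq ?_).trans h
    simp [Pi.norm_def]
  choose C hC using fun i : Fin n => hb (Pi.single i 1)
  have hC0 : ∀ i, 0 ≤ C i := fun i => by
    have := (norm_nonneg _).trans (hC i 0 le_rfl)
    simpa using this
  refine ⟨∑ i, C i, Finset.sum_nonneg fun i _ => hC0 i, fun t ht x => ?_⟩
  have hx : exp (t • A) *ᵥ x = ∑ i, x i • (exp (t • A) *ᵥ Pi.single i 1) := by
    conv_lhs => rw [pi_eq_sum_univ' x]
    rw [← Matrix.mulVecLin_apply, map_sum]
    refine Finset.sum_congr rfl fun i _ => ?_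
    rw [map_smul, Matrix.mulVecLin_apply]
  rw [hx, Finset.sum_mul, Finset.sum_mul]
  refine (norm_sum_le _ _).trans (Finset.sum_le_sum fun i _ => ?_)
  rw [norm_smul, mul_comm]
  exact mul_le_mul (hC i t ht) (norm_le_pi_norm x i) (norm_nonneg _)
    (mul_nonneg (hC0 i) (Real.exp_pos _).le)

theorem spectrum_transpose {𝕜 : Type*} [Field 𝕜] (M : Matrix (Fin n) (Fin n) 𝕜) :
    spectrum 𝕜 Mᵀ = spectrum 𝕜 M := by
  ext μ
  rw [Matrix.mem_spectrum_iff_isRoot_charpoly, Matrix.mem_spectrum_iff_isRoot_charpoly,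
    Matrix.charpoly_transpose]

theorem eigRe_transpose (A : Matrix (Fin n) (Fin n) ℝ) : eigRe Aᵀ = eigRe A := by
  rw [eigRe, eigRe, Matrix.transpose_map, spectrum_transpose]

theorem finite_eigRe (A : Matrix (Fin n) (Fin n) ℝ) : (eigRe A).Finite := by
  refine Set.Finite.image _ (((A.map fun r : ℝ => (r : ℂ)).charpoly.roots.toFinset.finite_toSet).subset
    fun μ hμ => ?_)
  rw [Matrix.mem_spectrum_iff_isRoot_charpoly] at hμ
  simpa [Polynomial.mem_roots (Matrix.charpoly_monic _).ne_zero] using hμ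

theorem nonempty_eigRe (hn : 0 < n) (A : Matrix (Fin n) (Fin n) ℝ) : (eigRe A).Nonempty := by
  have : Nonempty (Fin n) := ⟨⟨0, hn⟩⟩
  exact (spectrum.nonempty_of_isAlgClosed_of_finiteDimensional ℂ _).image _

theorem lt_of_lt_minRe {A : Matrix (Fin n) (Fin n) ℝ} {a : ℝ} (ha : a < minRe A) :
    ∀ r ∈ eigRe A, a < r := fun _ hr =>
  ha.trans_le (csInf_le (finite_eigRe A).bddBelow hr)

theorem maxRe_mem (hn : 0 < n) (A : Matrix (Fin n) (Fin n) ℝ) : maxRe A ∈ eigRe A :=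
  (nonempty_eigRe hn A).csSup_mem (finite_eigRe A)

/-- The flow `t ↦ exp (t A) x` grows at most like `exp (t max Re)` along some real functional. -/
theorem exists_functional_le (hn : 0 < n) (A : Matrix (Fin n) (Fin n) ℝ) :
    ∃ (u : Fin n → ℝ) (C : ℝ), u ≠ 0 ∧ 0 < C ∧ ∀ (t : ℝ) (x : Fin n → ℝ),
      |u ⬝ᵥ (exp (t • A) *ᵥ x)| ≤ C * Real.exp (t * maxRe A) * ‖x‖ := by
  obtain ⟨μ, hμ, hre⟩ := maxRe_mem hn A
  set M := A.map (fun r : ℝ => (r : ℂ)) with hM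
  rw [← spectrum_transpose, ← Matrix.spectrum_toLin', ← Module.End.hasEigenvalue_iff_mem_spectrum]
    at hμ
  obtain ⟨w, hw⟩ := hμ.exists_hasEigenvector
  have hw1 : (Mᵀ - μ • (1 : Matrix (Fin n) (Fin n) ℂ)) ^ 1 *ᵥ w = 0 := by
    have := hw.apply_eq_smul
    rw [Matrix.toLin'_apply] at this
    rw [pow_one, sub_mulVec, this, smul_mulVec, one_mulVec, sub_self]
  have hflow : ∀ (t : ℝ) (x : Fin n → ℝ), w ⬝ᵥ (fun i => ((exp (t • A) *ᵥ x) i : ℂ)) =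
      Complex.exp (t * μ) * (w ⬝ᵥ fun i => (x i : ℂ)) := by
    intro t x
    have h := exp_smul_mulVec_of_pow_sub_mulVec_eq_zero Mᵀ μ w 1 hw1 t
    simp only [Finset.range_one, Finset.sum_singleton, pow_zero, Nat.factorial_zero, Nat.cast_one,
      div_one, one_smul, one_mulVec] at h
    rw [← mulVec_map_ofReal, ← exp_smul_map_ofReal, ← hM, dotProduct_mulVec, ← mulVec_transpose,
      ← Matrix.exp_transpose, transpose_smul, h, smul_dotProduct, smul_eq_mul]
  have hbound : ∀ (t : ℝ) (x : Fin n → ℝ), ‖w ⬝ᵥ (fun i => ((exp (t • A) *ᵥ x) i : ℂ))‖ ≤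
      (∑ i, ‖w i‖) * Real.exp (t * maxRe A) * ‖x‖ := by
    intro t x
    rw [hflow, norm_mul, Complex.norm_exp]
    have : ((t : ℂ) * μ).re = t * maxRe A := by simp [← hre]
    rw [this, mul_comm (∑ i, ‖w i‖), mul_assoc]
    refine mul_le_mul_of_nonneg_left ?_ (Real.exp_pos _).le
    rw [Finset.sum_mul]
    refine (norm_sum_le _ _).trans (Finset.sum_le_sum fun i _ => ?_)
    rw [norm_mul, Complex.norm_real]
    exact mul_le_mul_of_nonneg_left (norm_le_pi_norm x i) (norm_nonneg _)
  have hC : 0 < ∑ i, ‖w i‖ := by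
    obtain ⟨i, hi⟩ := Function.ne_iff.1 hw.2
    exact (norm_pos_iff.2 hi).trans_le
      (Finset.single_le_sum (f := fun i => ‖w i‖) (fun i _ => norm_nonneg _) (Finset.mem_univ i))
  by_cases h0 : (fun i => (w i).re) = 0
  · refine ⟨fun i => (w i).im, _, fun h1 => hw.2 ?_, hC, fun t x => ?_⟩
    · funext i
      exact Complex.ext (congrFun h0 i) (congrFun h1 i)
    · refine le_trans (le_of_eq ?_) ((Complex.abs_im_le_norm _).trans (hbound t x))
      simp [dotProduct, Complex.im_sum]
  · refine ⟨fun i => (w i).re, _, h0, hC, fun t x => ?_⟩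
    refine le_trans (le_of_eq ?_) ((Complex.abs_re_le_norm _).trans (hbound t x))
    simp [dotProduct, Complex.re_sum]

end Decay

section Homogeneous

variable {n : ℕ}

theorem exists_pos_lt_eigRe {A : Matrix (Fin n) (Fin n) ℝ} (hA : ∀ r ∈ eigRe A, 0 < r) :
    ∃ a : ℝ, 0 < a ∧ ∀ r ∈ eigRe A, a < r := by
  rcases (eigRe A).eq_empty_or_nonempty with h | h
  · exact ⟨1, one_pos, by simp [h]⟩
  · have hm := h.csInf_mem (finite_eigRe A)
    have hp := hA _ hm
    refine ⟨sInf (eigRe A) / 2, by positivity, fun r hr => ?_⟩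
    have := csInf_le (finite_eigRe A).bddBelow hr
    linarith

theorem continuous_exp_smul_mulVec (A : Matrix (Fin n) (Fin n) ℝ) (x : Fin n → ℝ) :
    Continuous fun t : ℝ => exp (t • A) *ᵥ x := by
  refine continuous_pi fun i => ?_
  simp only [mulVec, dotProduct]
  refine continuous_finsetSum _ fun j _ => Continuous.mul ?_ continuous_const
  exact continuous_iff_continuousAt.2 fun t => (hasDerivAt_exp_smul_apply A t i j).continuousAt

/-- Every orbit of the flow `exp (t A)` crosses the unit sphere. -/
theorem exists_norm_exp_smul_mulVec_eq_one {A : Matrix (Fin n) (Fin n) ℝ}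
    (hA : ∀ r ∈ eigRe A, 0 < r) {z : Fin n → ℝ} (hz : z ≠ 0) :
    ∃ t : ℝ, ‖exp (t • A) *ᵥ z‖ = 1 := by
  obtain ⟨a, ha, haA⟩ := exists_pos_lt_eigRe hA
  obtain ⟨C, hC0, hC⟩ := exists_norm_exp_smul_mulVec_le A haA
  have hlim : ∀ c : ℝ, Filter.Tendsto (fun t : ℝ => C * Real.exp (a * t) * c)
      Filter.atBot (nhds 0) := by
    intro c
    have h1 : Filter.Tendsto (fun t : ℝ => a * t) Filter.atBot Filter.atBot :=
      Filter.tendsto_id.const_mul_atBot ha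
    simpa using ((Real.tendsto_exp_atBot.comp h1).const_mul C).mul_const c
  have hz' : 0 < ‖z‖ := norm_pos_iff.2 hz
  have h1 : ∃ t : ℝ, ‖exp (t • A) *ᵥ z‖ ≤ 1 := by
    obtain ⟨t, ht, ht0⟩ := (((hlim ‖z‖).eventually (ge_mem_nhds one_pos)).and
      (Filter.eventually_le_atBot 0)).exists
    exact ⟨t, (hC t ht0 z).trans ht⟩
  have h2 : ∃ t : ℝ, 1 ≤ ‖exp (t • A) *ᵥ z‖ := by
    obtain ⟨t, ht, ht0⟩ := (((hlim 1).eventually (ge_mem_nhds hz')).and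
      (Filter.eventually_le_atBot 0)).exists
    refine ⟨-t, ?_⟩
    by_contra! hlt
    have h := hC t ht0 (exp ((-t) • A) *ᵥ z)
    have e := exp_neg_smul_mulVec_exp_smul A (-t) z
    rw [neg_neg] at e
    rw [e] at h
    rw [mul_one] at ht
    have hlt' : C * Real.exp (a * t) * ‖exp ((-t) • A) *ᵥ z‖ < ‖z‖ := by
      rcases hC0.eq_or_lt with h0 | h0
      · simpa [← h0] using hz'
      · calc _ < C * Real.exp (a * t) * 1 := by
              refine mul_lt_mul_of_pos_left hlt (by positivity)
          _ ≤ _ := by rwa [mul_one]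
    exact absurd h (not_le.2 hlt')
  exact mem_range_of_exists_le_of_exists_ge (continuous_exp_smul_mulVec A z).norm h1 h2

namespace IsHomogeneous

variable {A : Matrix (Fin n) (Fin n) ℝ} {ψ : (Fin n → ℝ) → ℝ}

theorem map_exp_smul_mulVec (hψ : IsHomogeneous A ψ) (t : ℝ) (x : Fin n → ℝ) :
    ψ (exp (t • A) *ᵥ x) = Real.exp t * ψ x := by
  have := hψ.homogeneous (Real.exp t) (Real.exp_pos t) x
  rwa [matPow, Real.log_exp] at this

theorem pos (hψ : IsHomogeneous A ψ) {x : Fin n → ℝ} (hx : x ≠ 0) : 0 < ψ x :=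
  (hψ.nonneg x).lt_of_ne' (hψ.ne_zero x hx)

theorem norm_le_of_le (hψ : IsHomogeneous A ψ) (hA : ∀ r ∈ eigRe A, 0 < r) (M : ℝ) :
    ∃ R : ℝ, ∀ ξ, ψ ξ ≤ M → ‖ξ‖ ≤ R := by
  rcases Nat.eq_zero_or_pos n with rfl | hn
  · exact ⟨0, fun ξ _ => by simp [Subsingleton.elim ξ 0]⟩
  obtain ⟨a, ha, haA⟩ := exists_pos_lt_eigRe hA
  obtain ⟨C, hC0, hC⟩ := exists_norm_exp_smul_mulVec_le A haA
  have : Nonempty (Fin n) := ⟨⟨0, hn⟩⟩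
  obtain ⟨u₀, hu₀, hmin⟩ := (isCompact_sphere (0 : Fin n → ℝ) 1).exists_isMinOn
    (NormedSpace.sphere_nonempty.2 zero_le_one) hψ.continuous.continuousOn
  have hc : 0 < ψ u₀ := hψ.pos (by rintro rfl; simp at hu₀)
  set T := Real.log (M / ψ u₀) with hT
  obtain ⟨B, hB⟩ := ((isCompact_sphere (0 : Fin n → ℝ) 1).image
    (f := fun u => exp (T • A) *ᵥ u) (by fun_prop)).isBounded.exists_norm_le
  refine ⟨max 0 (C * B), fun ξ hξ => ?_⟩
  by_cases h0 : ξ = 0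
  · simp [h0]
  obtain ⟨t, ht⟩ := exists_norm_exp_smul_mulVec_eq_one hA h0
  set u := exp (t • A) *ᵥ ξ with hu
  have hus : u ∈ Metric.sphere (0 : Fin n → ℝ) 1 := by simpa using ht
  have h1 : ψ u₀ ≤ Real.exp t * M := by
    refine (hmin hus).trans ?_
    simp only [hu]
    rw [hψ.map_exp_smul_mulVec]
    exact mul_le_mul_of_nonneg_left hξ (Real.exp_pos t).le
  have hM : 0 < M := (hψ.pos h0).trans_le hξ
  have hle : -t - T ≤ 0 := by
    rw [sub_nonpos, hT, Real.le_log_iff_exp_le (by positivity), Real.exp_neg, le_div_iff₀ hc,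
      inv_mul_le_iff₀ (Real.exp_pos _)]
    exact h1
  have hξe : ξ = exp ((-t - T) • A) *ᵥ (exp (T • A) *ᵥ u) := by
    rw [mulVec_mulVec, ← exp_add_smul, sub_add_cancel, hu, exp_neg_smul_mulVec_exp_smul]
  rw [hξe]
  refine (hC _ hle _).trans (le_max_of_le_right ?_)
  have hBu := hB _ (mem_image_of_mem _ hus)
  refine mul_le_mul ?_ hBu (norm_nonneg _) hC0
  exact mul_le_of_le_one_right hC0 (Real.exp_le_one_iff.2 (mul_nonpos_of_nonneg_of_nonpos ha.le hle))

end IsHomogeneous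

/-- Preimages under the flow scale Lebesgue measure by `exp (-t tr A)`. -/
theorem volume_preimage_exp_smul (A : Matrix (Fin n) (Fin n) ℝ) (t : ℝ) (s : Set (Fin n → ℝ)) :
    volume ((fun ξ => exp (t • A) *ᵥ ξ) ⁻¹' s) =
      ENNReal.ofReal (Real.exp (-(t * A.trace))) * volume s := by
  have hdet : LinearMap.det (Matrix.toLin' (exp (t • A))) = Real.exp (t * A.trace) := by
    rw [LinearMap.det_toLin', det_exp_smul]
  have h := Measure.addHaar_preimage_linearMap (volume : Measure (Fin n → ℝ))
    (f := Matrix.toLin' (exp (t • A))) (by rw [hdet]; exact (Real.exp_pos _).ne') s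
  rw [hdet, ← Real.exp_neg, abs_of_pos (Real.exp_pos _)] at h
  exact h

/-- One factor of the kernel. -/
def factor (ψ : (Fin n → ℝ) → ℝ) (β : ℝ) (x ξ : Fin n → ℝ) : ℂ :=
  (Complex.exp (Complex.I * ((x ⬝ᵥ ξ : ℝ) : ℂ)) - 1) * ((ψ ξ ^ β : ℝ) : ℂ)

theorem summable_exp_neg_mul_abs {δ : ℝ} (hδ : 0 < δ) :
    Summable fun k : ℤ => Real.exp (-(δ * |(k : ℝ)|)) := by
  have h : Summable fun k : ℕ => Real.exp (-(δ * (k : ℝ))) := by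
    have := Real.summable_exp_nat_mul_iff.2 (neg_lt_zero.2 hδ)
    refine this.congr fun k => ?_
    congr 1; ring
  refine Summable.of_nat_of_neg ?_ ?_ <;> simpa using h

theorem norm_exp_I_mul_sub_one_le_abs (θ : ℝ) :
    ‖Complex.exp (Complex.I * (θ : ℂ)) - 1‖ ≤ |θ| := by
  simpa using Real.norm_exp_I_mul_ofReal_sub_one_le (x := θ)

theorem norm_exp_I_mul_sub_one_le_two (θ : ℝ) :
    ‖Complex.exp (Complex.I * (θ : ℂ)) - 1‖ ≤ 2 := by
  refine (norm_sub_le _ _).trans ?_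
  rw [mul_comm, Complex.norm_exp_ofReal_mul_I, norm_one]
  norm_num

theorem abs_dotProduct_le (x y : Fin n → ℝ) : |x ⬝ᵥ y| ≤ n * ‖x‖ * ‖y‖ := by
  refine (Finset.abs_sum_le_sum_abs _ _).trans ?_
  have : ∀ i ∈ Finset.univ, |x i * y i| ≤ ‖x‖ * ‖y‖ := fun i _ => by
    rw [abs_mul]
    exact mul_le_mul (norm_le_pi_norm x i) (norm_le_pi_norm y i) (abs_nonneg _) (norm_nonneg _)
  refine (Finset.sum_le_card_nsmul _ _ _ this).trans (le_of_eq ?_)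
  simp [mul_assoc]

namespace IsHomogeneous

variable {A : Matrix (Fin n) (Fin n) ℝ} {ψ : (Fin n → ℝ) → ℝ}

theorem measurable_factor (hψ : IsHomogeneous A ψ) (β : ℝ) (x : Fin n → ℝ) :
    Measurable (factor ψ β x) := by
  have h1 : Measurable fun ξ => ψ ξ ^ β := hψ.continuous.measurable.pow_const β
  have h2 : Measurable fun ξ : Fin n → ℝ => x ⬝ᵥ ξ :=
    Continuous.measurable (by simp only [dotProduct]; fun_prop)
  unfold factor
  fun_prop

theorem integrable_norm_factor_rpow (hψ : IsHomogeneous A ψ) (hA : ∀ r ∈ eigRe A, 0 < r)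
    {α H : ℝ} (hα : 0 < α) (hH : 0 < H) (hHA : ∃ a, H < a ∧ ∀ r ∈ eigRe A, a < r)
    (x : Fin n → ℝ) :
    Integrable fun ξ => ‖factor ψ (-H - A.trace / α) x ξ‖ ^ α := by
  obtain ⟨a, hHa, haA⟩ := hHA
  obtain ⟨C, hC0, hC⟩ := exists_norm_exp_smul_mulVec_le A haA
  obtain ⟨R, hR⟩ := hψ.norm_le_of_le hA (Real.exp 1)
  set β := -H - A.trace / α with hβ
  refine ⟨((hψ.measurable_factor β x).norm.pow_const α).aestronglyMeasurable, ?_⟩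
  set shell : ℤ → Set (Fin n → ℝ) := fun k => {ξ | Real.exp k ≤ ψ ξ ∧ ψ ξ < Real.exp (k + 1)}
    with hshell
  have hms : ∀ k, MeasurableSet (shell k) := fun k =>
    (measurableSet_le measurable_const hψ.continuous.measurable).inter
      (measurableSet_lt hψ.continuous.measurable measurable_const)
  have hshift : ∀ k : ℤ, shell k = (fun ξ => exp ((-k : ℝ) • A) *ᵥ ξ) ⁻¹' shell 0 := by
    intro k
    ext ξ
    simp only [hshell, mem_ofPred_eq, mem_preimage, hψ.map_exp_smul_mulVec, Int.cast_zero, zero_add]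
    rw [Real.exp_neg, le_inv_mul_iff₀ (Real.exp_pos _), inv_mul_lt_iff₀ (Real.exp_pos _),
      ← Real.exp_add, ← Real.exp_add, add_zero]
  have hvol : ∀ k : ℤ, volume (shell k) =
      ENNReal.ofReal (Real.exp (k * A.trace)) * volume (shell 0) := by
    intro k
    rw [hshift k, volume_preimage_exp_smul]
    congr 4; ring
  have hV : volume (shell 0) < ⊤ := by
    refine (measure_mono (t := Metric.closedBall 0 R) fun ξ hξ => ?_).trans_lt
      measure_closedBall_lt_top
    rw [mem_closedBall_zero_iff]
    refine hR ξ (by simpa [hshell] using hξ.2.le)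
  set D : ℝ := max 2 (n * ‖x‖ * (C * R)) with hD
  have hD0 : 0 < D := lt_max_of_lt_left two_pos
  set c : ℤ → ℝ := fun k => (D * Real.exp (a * min (k : ℝ) 0) * (Real.exp |β| * Real.exp (k * β))) ^ α
    with hc
  have hexp : ∀ (k : ℤ) (ξ), ξ ∈ shell k →
      ‖Complex.exp (Complex.I * ((x ⬝ᵥ ξ : ℝ) : ℂ)) - 1‖ ≤ D * Real.exp (a * min (k : ℝ) 0) := by
    intro k ξ hξ
    rcases le_total (k : ℝ) 0 with hk | hk
    · rw [min_eq_left hk]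
      refine (norm_exp_I_mul_sub_one_le_abs _).trans ((abs_dotProduct_le x ξ).trans ?_)
      rw [hshift k] at hξ
      set η := exp ((-k : ℝ) • A) *ᵥ ξ with hη
      have hξη : ξ = exp ((k : ℝ) • A) *ᵥ η := by
        have := exp_neg_smul_mulVec_exp_smul A (-k : ℝ) ξ
        rw [neg_neg] at this
        exact this.symm
      have hηR : ‖η‖ ≤ R := by
        have h : ψ η ≤ Real.exp ((0 : ℤ) + 1) := hξ.2.le
        exact hR η (by simpa only [Int.cast_zero, zero_add] using h)
      have h1 : ‖ξ‖ ≤ C * Real.exp (a * k) * R := by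
        conv_lhs => rw [hξη]
        exact (hC _ hk η).trans (mul_le_mul_of_nonneg_left hηR (by positivity))
      calc n * ‖x‖ * ‖ξ‖ ≤ n * ‖x‖ * (C * Real.exp (a * k) * R) :=
            mul_le_mul_of_nonneg_left h1 (by positivity)
        _ = n * ‖x‖ * (C * R) * Real.exp (a * k) := by ring
        _ ≤ D * Real.exp (a * k) :=
            mul_le_mul_of_nonneg_right (le_max_right _ _) (Real.exp_pos _).le
    · rw [min_eq_right hk, mul_zero, Real.exp_zero, mul_one]
      exact (norm_exp_I_mul_sub_one_le_two _).trans (le_max_left _ _)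
  have hpow : ∀ (k : ℤ) (ξ), ξ ∈ shell k → ψ ξ ^ β ≤ Real.exp |β| * Real.exp (k * β) := by
    intro k ξ hξ
    have h0 : 0 < ψ ξ := (Real.exp_pos _).trans_le hξ.1
    have h1 : (k : ℝ) ≤ Real.log (ψ ξ) := (Real.le_log_iff_exp_le h0).2 hξ.1
    have h2 : Real.log (ψ ξ) < k + 1 := (Real.log_lt_iff_lt_exp h0).2 hξ.2
    rw [Real.rpow_def_of_pos h0, ← Real.exp_add, Real.exp_le_exp]
    have h3 : (Real.log (ψ ξ) - k) * β ≤ 1 * |β| :=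
      (mul_le_mul_of_nonneg_left (le_abs_self β) (by linarith)).trans
        (mul_le_mul_of_nonneg_right (by linarith) (abs_nonneg β))
    linarith
  have hle : ∀ (k : ℤ) (ξ), ξ ∈ shell k → ‖factor ψ β x ξ‖ ^ α ≤ c k := by
    intro k ξ hξ
    refine Real.rpow_le_rpow (norm_nonneg _) ?_ hα.le
    rw [factor, norm_mul, Complex.norm_real, Real.norm_of_nonneg (Real.rpow_nonneg (hψ.nonneg _) _)]
    exact mul_le_mul (hexp k ξ hξ) (hpow k ξ hξ) (Real.rpow_nonneg (hψ.nonneg _) _) (by positivity)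
  have hdom : ∀ ξ, ‖‖factor ψ β x ξ‖ ^ α‖ₑ ≤
      ∑' k, (shell k).indicator (fun _ => ENNReal.ofReal (c k)) ξ := by
    intro ξ
    by_cases h0 : ξ = 0
    · simp [h0, factor, hα.ne']
    have hp := hψ.pos h0
    set k := ⌊Real.log (ψ ξ)⌋ with hk
    have hmem : ξ ∈ shell k := by
      constructor
      · rw [← Real.le_log_iff_exp_le hp]; exact Int.floor_le _
      · rw [← Real.log_lt_iff_lt_exp hp]; exact Int.lt_floor_add_one _
    refine le_trans ?_ (ENNReal.le_tsum k)
    rw [indicator_of_mem hmem, Real.enorm_of_nonneg (by positivity)]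
    exact ENNReal.ofReal_le_ofReal (hle k ξ hmem)
  set δ := α * min H (a - H) with hδ
  have hδ0 : 0 < δ := mul_pos hα (lt_min hH (sub_pos.2 hHa))
  have hck : ∀ k : ℤ, c k * Real.exp (k * A.trace) ≤
      (D * Real.exp |β|) ^ α * Real.exp (-(δ * |(k : ℝ)|)) := by
    intro k
    have e1 : c k = (D * Real.exp |β|) ^ α * Real.exp ((a * min (k : ℝ) 0 + k * β) * α) := by
      rw [Real.exp_mul, ← Real.mul_rpow (by positivity) (by positivity), Real.exp_add]
      simp only [hc]
      congr 1; ring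
    rw [e1, mul_assoc, ← Real.exp_add]
    refine mul_le_mul_of_nonneg_left (Real.exp_le_exp.2 ?_) (by positivity)
    have e2 : (a * min (k : ℝ) 0 + k * β) * α + k * A.trace = α * (a * min (k : ℝ) 0 - k * H) := by
      rw [hβ]; field_simp; ring
    rw [e2, hδ, mul_assoc, ← mul_neg]
    refine mul_le_mul_of_nonneg_left ?_ hα.le
    rcases le_total (k : ℝ) 0 with hk | hk
    · rw [min_eq_left hk, abs_of_nonpos hk]
      nlinarith [min_le_right H (a - H)]
    · rw [min_eq_right hk, abs_of_nonneg hk]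
      nlinarith [min_le_left H (a - H)]
  calc ∫⁻ ξ, ‖‖factor ψ β x ξ‖ ^ α‖ₑ
      ≤ ∫⁻ ξ, ∑' k, (shell k).indicator (fun _ => ENNReal.ofReal (c k)) ξ :=
        lintegral_mono hdom
    _ = ∑' k, ENNReal.ofReal (c k) * volume (shell k) := by
        rw [lintegral_tsum fun k => (measurable_const.indicator (hms k)).aemeasurable]
        simp_rw [lintegral_indicator_const (hms _)]
    _ ≤ ∑' k : ℤ, ENNReal.ofReal ((D * Real.exp |β|) ^ α * Real.exp (-(δ * |(k : ℝ)|))) *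
          volume (shell 0) := by
        refine ENNReal.tsum_le_tsum fun k => ?_
        rw [hvol k, ← mul_assoc, ← ENNReal.ofReal_mul (by positivity)]
        exact mul_le_mul' (ENNReal.ofReal_le_ofReal (hck k)) le_rfl
    _ < ⊤ := by
        rw [ENNReal.tsum_mul_right]
        refine ENNReal.mul_lt_top ?_ hV
        rw [← ENNReal.ofReal_tsum_of_nonneg (fun k => by positivity)
          ((summable_exp_neg_mul_abs hδ0).mul_left _)]
        exact ENNReal.ofReal_lt_top

end IsHomogeneous

end Homogeneous

section Scale

variable {m : ℕ} {d : Fin m → ℕ} {α : ℝ} {E : (j : Fin m) → Matrix (Fin (d j)) (Fin (d j)) ℝ}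
  {H : Fin m → ℝ} {ψ : (j : Fin m) → (Fin (d j) → ℝ) → ℝ}

theorem memLp_kernel (hE : ∀ j, ∀ r ∈ eigRe (E j), 0 < r) (hα : 0 < α)
    (hH : ∀ j, 0 < H j ∧ H j < minRe (E j)) (hψ : ∀ j, IsHomogeneous (E j)ᵀ (ψ j)) (x : Space d) :
    MemLp (kernel α E H ψ x) (ENNReal.ofReal α) volume := by
  have hm : Measurable (kernel α E H ψ x) := by
    refine Finset.measurable_fun_prod _ fun j _ => ?_
    exact ((hψ j).measurable_factor _ (x j)).comp (measurable_pi_apply j)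
  rw [← integrable_norm_rpow_iff hm.aestronglyMeasurable (by simpa using hα) (by simp),
    ENNReal.toReal_ofReal hα.le]
  have h : ∀ j, Integrable fun ξ => ‖factor (ψ j) (-H j - (E j).trace / α) (x j) ξ‖ ^ α := by
    intro j
    obtain ⟨a, ha1, ha2⟩ := exists_between (hH j).2
    have := (hψ j).integrable_norm_factor_rpow (by rw [eigRe_transpose]; exact hE j) hα (hH j).1
      ⟨a, ha1, by rw [eigRe_transpose]; exact lt_of_lt_minRe ha2⟩ (x j)
    rwa [trace_transpose] at this
  refine (Integrable.fintype_prod_dep h).congr (Filter.Eventually.of_forall fun ξ => ?_)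
  simp only [kernel, norm_prod]
  rw [← Real.finsetProd_rpow _ _ fun i _ => norm_nonneg _]
  rfl

theorem scale_eq {Ω : Type*} [MeasurableSpace Ω] {P : Measure Ω} {Y : Ω → ℝ} (hα : 0 < α)
    {s : ℝ} (hs : 0 ≤ s)
    (h : ∀ t : ℝ, ∫ ω, Complex.exp (Complex.I * ((t * Y ω : ℝ) : ℂ)) ∂P =
      ((Real.exp (-(s ^ α * |t| ^ α)) : ℝ) : ℂ)) :
    scale α P Y = s := by
  have : {s : ℝ | 0 ≤ s ∧ ∀ t : ℝ, ∫ ω, Complex.exp (Complex.I * ((t * Y ω : ℝ) : ℂ)) ∂P =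
      ((Real.exp (-(s ^ α * |t| ^ α)) : ℝ) : ℂ)} = {s} := by
    refine eq_singleton_iff_unique_mem.2 ⟨⟨hs, h⟩, fun s' ⟨hs', h'⟩ => ?_⟩
    have e := (h' 1).symm.trans (h 1)
    rw [Complex.ofReal_inj, Real.exp_eq_exp, neg_inj, abs_one, Real.one_rpow, mul_one, mul_one] at e
    exact (Real.rpow_left_inj hs' hs hα.ne').1 e
  rw [scale, this, csInf_singleton]

theorem sigma_eq {Ω : Type*} [MeasurableSpace Ω] {P : Measure Ω} {κ : ℝ} (hκ : 0 < κ)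
    {W : (Space d → ℂ) → Ω → ℂ} (hW : IsIsotropicStableIntegral α κ volume P W) (hα : 0 < α)
    (hk : ∀ x, MemLp (kernel α E H ψ x) (ENNReal.ofReal α) volume) (x y : Space d) :
    sigma α E H ψ P W x y =
      (κ * ∫ ξ, ‖kernel α E H ψ x ξ - kernel α E H ψ y ξ‖ ^ α) ^ α⁻¹ := by
  have hI : 0 ≤ κ * ∫ ξ, ‖kernel α E H ψ x ξ - kernel α E H ψ y ξ‖ ^ α :=
    mul_nonneg hκ.le (integral_nonneg fun ξ => by positivity)
  refine scale_eq hα (Real.rpow_nonneg hI _) fun t => ?_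
  have h := hW.charFun_eq 2 ![kernel α E H ψ x, kernel α E H ψ y] ![(t : ℂ), -(t : ℂ)] (by
    intro k; fin_cases k
    · exact hk x
    · exact hk y)
  simp only [Fin.sum_univ_two, cons_val_zero, cons_val_one, map_neg, Complex.conj_ofReal] at h
  rw [Real.rpow_inv_rpow hI hα.ne']
  have e : ∫ ξ, ‖(t : ℂ) * kernel α E H ψ x ξ + -(t : ℂ) * kernel α E H ψ y ξ‖ ^ α =
      (∫ ξ, ‖kernel α E H ψ x ξ - kernel α E H ψ y ξ‖ ^ α) * |t| ^ α := by
    rw [← integral_mul_const]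
    congr 1
    funext ξ
    rw [neg_mul, ← sub_eq_add_neg, ← mul_sub, norm_mul, Complex.norm_real, Real.norm_eq_abs,
      Real.mul_rpow (abs_nonneg _) (norm_nonneg _), mul_comm]
  rw [e, ← mul_assoc] at h
  rw [← h]
  congr 1
  funext ω
  congr 3
  simp [sheet]
  ring

end Scale

section LowerBound

theorem abs_re_mul_one_sub_exp_le {P Q : ℂ} {C : ℝ} (hP : ‖P‖ ≤ C) (hQ : ‖Q‖ ≤ C) (θ η : ℝ) :
    |(P * starRingEnd ℂ Q * (1 - Complex.exp (Complex.I * ((θ - η : ℝ) : ℂ)))).re| ≤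
      2 * C * ‖(Complex.exp (Complex.I * (θ : ℂ)) - 1) * P -
        (Complex.exp (Complex.I * (η : ℂ)) - 1) * Q‖ := by
  set a := Complex.exp (Complex.I * (θ : ℂ)) with ha
  set b := Complex.exp (Complex.I * (η : ℂ)) with hb
  have hna : ‖a‖ = 1 := by rw [ha, mul_comm, Complex.norm_exp_ofReal_mul_I]
  have hnb : ‖b‖ = 1 := by rw [hb, mul_comm, Complex.norm_exp_ofReal_mul_I]
  have hab : Complex.exp (Complex.I * ((θ - η : ℝ) : ℂ)) = a * starRingEnd ℂ b := by
    rw [ha, hb, ← Complex.exp_conj, ← Complex.exp_add]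
    congr 1
    simp
    ring
  have hsq : ‖P - Q‖ ^ 2 + 2 * (P * starRingEnd ℂ Q).re = ‖a * P - b * Q‖ ^ 2 +
      2 * (a * P * starRingEnd ℂ (b * Q)).re := by
    have h1 : ∀ z w : ℂ, ‖z - w‖ ^ 2 + 2 * (z * starRingEnd ℂ w).re = ‖z‖ ^ 2 + ‖w‖ ^ 2 := by
      intro z w
      simp only [Complex.sq_norm, Complex.normSq_apply, Complex.mul_re, Complex.conj_re,
        Complex.conj_im, Complex.sub_re, Complex.sub_im]
      ring
    rw [h1, h1, norm_mul, norm_mul, hna, hnb, one_mul, one_mul]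
  have hre : 2 * (P * starRingEnd ℂ Q * (1 - a * starRingEnd ℂ b)).re =
      ‖a * P - b * Q‖ ^ 2 - ‖P - Q‖ ^ 2 := by
    have : P * starRingEnd ℂ Q * (1 - a * starRingEnd ℂ b) =
        P * starRingEnd ℂ Q - a * P * starRingEnd ℂ (b * Q) := by
      rw [map_mul]; ring
    rw [this, Complex.sub_re]
    linarith
  rw [hab]
  have hD : (a - 1) * P - (b - 1) * Q = (a * P - b * Q) - (P - Q) := by ring
  rw [hD]
  have hu : ‖a * P - b * Q‖ ≤ 2 * C := by
    refine (norm_sub_le _ _).trans ?_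
    rw [norm_mul, norm_mul, hna, hnb, one_mul, one_mul]; linarith
  have hv : ‖P - Q‖ ≤ 2 * C := (norm_sub_le _ _).trans (by linarith)
  have h2 := abs_norm_sub_norm_le (a * P - b * Q) (P - Q)
  have h3 : |2 * (P * starRingEnd ℂ Q * (1 - a * starRingEnd ℂ b)).re| ≤
      ‖(a * P - b * Q) - (P - Q)‖ * (4 * C) := by
    rw [hre, sq_sub_sq, abs_mul, mul_comm]
    refine mul_le_mul h2 ?_ (abs_nonneg _) (norm_nonneg _)
    rw [abs_of_nonneg (by positivity)]
    linarith
  rw [abs_mul, abs_two] at h3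
  linarith

theorem quarter_le_sin {τ : ℝ} (h1 : 1 / 2 ≤ τ) (h2 : τ ≤ 3 / 2) : 1 / 4 ≤ Real.sin τ := by
  have hpi := Real.pi_gt_three
  refine le_trans ?_ (Real.mul_le_sin (by linarith) (by linarith))
  rw [div_mul_eq_mul_div, le_div_iff₀ Real.pi_pos]
  linarith [Real.pi_le_four]

theorem cos_le_of_mem {τ : ℝ} (h1 : 1 / 2 ≤ τ) (h2 : τ ≤ 3 / 2) : Real.cos τ ≤ 1 - 1 / 32 := by
  have hs := quarter_le_sin h1 h2
  nlinarith [Real.sin_sq_add_cos_sq τ]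

theorem abs_add_abs_le_of_mul_nonneg {a b c s : ℝ} (hab : 0 ≤ a * b) (hc : 1 / 32 ≤ c)
    (hs : 1 / 32 ≤ s) : (|a| + |b|) / 32 ≤ |a * c + b * s| := by
  rcases mul_nonneg_iff.1 hab with ⟨ha, hb⟩ | ⟨ha, hb⟩
  · rw [abs_of_nonneg ha, abs_of_nonneg hb]
    refine le_trans ?_ (le_abs_self _)
    nlinarith
  · rw [abs_of_nonpos ha, abs_of_nonpos hb]
    refine le_trans ?_ (neg_le_abs _)
    nlinarith

theorem exists_sign_le_abs_re (w : ℂ) : ∃ e : ℝ, |e| = 1 ∧ ∀ τ : ℝ, 1 / 2 ≤ e * τ → e * τ ≤ 3 / 2 →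
    ‖w‖ / 32 ≤ |(w * (1 - Complex.exp (Complex.I * (τ : ℂ)))).re| := by
  have hre : ∀ τ : ℝ, (w * (1 - Complex.exp (Complex.I * (τ : ℂ)))).re =
      w.re * (1 - Real.cos τ) + w.im * Real.sin τ := by
    intro τ
    rw [mul_comm Complex.I, Complex.exp_mul_I]
    simp [← Complex.ofReal_cos, ← Complex.ofReal_sin]
  have hw := Complex.norm_le_abs_re_add_abs_im w
  rcases le_total 0 (w.re * w.im) with h | h
  · refine ⟨1, abs_one, fun τ h1 h2 => ?_⟩
    rw [one_mul] at h1 h2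
    have hs := quarter_le_sin h1 h2
    have hc := cos_le_of_mem h1 h2
    rw [hre]
    exact le_trans (by linarith)
      (abs_add_abs_le_of_mul_nonneg h (c := 1 - Real.cos τ) (by linarith) (by linarith))
  · refine ⟨-1, by simp, fun τ h1 h2 => ?_⟩
    rw [neg_one_mul] at h1 h2
    have hs := quarter_le_sin h1 h2
    have hc := cos_le_of_mem h1 h2
    rw [Real.sin_neg] at hs
    rw [Real.cos_neg] at hc
    have hb := abs_add_abs_le_of_mul_nonneg (a := w.re) (b := -w.im) (by linarith)
      (c := 1 - Real.cos τ) (s := -Real.sin τ) (by linarith) (by linarith)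
    rw [neg_mul_neg, abs_neg] at hb
    rw [hre]
    exact le_trans (by linarith) hb

theorem quarter_le_norm_exp_sub_one {τ : ℝ} (h1 : 1 / 2 ≤ τ) (h2 : τ ≤ 3 / 2) :
    1 / 4 ≤ ‖Complex.exp (Complex.I * (τ : ℂ)) - 1‖ := by
  refine le_trans ?_ (Complex.abs_im_le_norm _)
  rw [mul_comm, Complex.exp_mul_I]
  simp [← Complex.ofReal_cos, ← Complex.ofReal_sin]
  refine le_trans ?_ (le_abs_self _)
  have := quarter_le_sin h1 h2
  linarith

variable {n : ℕ}

theorem IsHomogeneous.exists_pos_le_rpow {A : Matrix (Fin n) (Fin n) ℝ} {ψ : (Fin n → ℝ) → ℝ}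
    (hψ : IsHomogeneous A ψ) (β : ℝ) {K : Set (Fin n → ℝ)} (hK : IsCompact K)
    (h0 : (0 : Fin n → ℝ) ∉ K) : ∃ c : ℝ, 0 < c ∧ ∀ ξ ∈ K, c ≤ ψ ξ ^ β := by
  have hne : ∀ ξ ∈ K, ξ ≠ 0 := fun ξ hξ h => h0 (h ▸ hξ)
  rcases K.eq_empty_or_nonempty with rfl | hne'
  · exact ⟨1, one_pos, by simp⟩
  obtain ⟨ξ₀, hξ₀, hmin⟩ := hK.exists_isMinOn hne' (f := fun ξ => ψ ξ ^ β)
    (hψ.continuous.continuousOn.rpow_const fun ξ hξ => Or.inl (hψ.ne_zero ξ (hne ξ hξ)))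
  exact ⟨_, Real.rpow_pos_of_pos (hψ.pos (hne _ hξ₀)) β, fun ξ hξ => hmin hξ⟩

/-- For a unit vector `l`, a ball of fixed size in a fixed annulus on which `⟨l, ·⟩` is
bounded above and below. -/
theorem exists_closedBall_dotProduct_mem (hn : 0 < n) {l : Fin n → ℝ} (hl : ‖l‖ = 1) :
    ∃ v : Fin n → ℝ, ∀ η ∈ Metric.closedBall v (1 / (2 * n)),
      1 / 2 ≤ l ⬝ᵥ η ∧ l ⬝ᵥ η ≤ 3 / 2 ∧ 1 / 2 ≤ ‖η‖ ∧ ‖η‖ ≤ 3 / 2 := by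
  have : Nonempty (Fin n) := ⟨⟨0, hn⟩⟩
  obtain ⟨i, hi'⟩ := Finite.exists_max fun i => ‖l i‖
  have hi : |l i| = 1 := by
    rw [← Real.norm_eq_abs, ← hl]
    exact le_antisymm (norm_le_pi_norm l i) ((pi_norm_le_iff_of_nonempty _).2 hi')
  have hn' : (1 : ℝ) ≤ n := by exact_mod_cast hn
  set v : Fin n → ℝ := Pi.single i (l i) with hv
  have hvn : ‖v‖ = 1 := by rw [hv, Pi.norm_single, Real.norm_eq_abs, hi]
  have hlv : l ⬝ᵥ v = 1 := by
    rw [hv, dotProduct_single, ← abs_mul_abs_self, hi, one_mul]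
  refine ⟨v, fun η hη => ?_⟩
  rw [mem_closedBall_iff_norm] at hη
  have hδ : 1 / (2 * (n : ℝ)) ≤ 1 / 2 := by
    rw [div_le_div_iff₀ (by positivity) (by positivity)]; linarith
  have hdev : |l ⬝ᵥ η - 1| ≤ 1 / 2 := by
    have e : l ⬝ᵥ η - 1 = l ⬝ᵥ (η - v) := by rw [dotProduct_sub, hlv]
    rw [e]
    refine (abs_dotProduct_le _ _).trans ?_
    rw [hl, mul_one]
    refine (mul_le_mul_of_nonneg_left hη (by positivity)).trans (le_of_eq ?_)
    field_simp
  have hnorm : |‖η‖ - 1| ≤ 1 / 2 := by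
    have := abs_norm_sub_norm_le η v
    rw [hvn] at this
    exact this.trans (hη.trans hδ)
  rw [abs_le] at hdev hnorm
  refine ⟨?_, ?_, ?_, ?_⟩ <;> linarith

theorem dotProduct_mem_of_mem_Icc (hn : 0 < n) {x ξ : Fin n → ℝ} (hx : ∀ i, 1 / 2 ≤ x i ∧ x i ≤ 1)
    (hξ : ξ ∈ Icc (fun _ => 1 / (n : ℝ)) (fun _ => 3 / (2 * (n : ℝ)))) :
    1 / 2 ≤ x ⬝ᵥ ξ ∧ x ⬝ᵥ ξ ≤ 3 / 2 := by
  have hn' : (0 : ℝ) < n := by exact_mod_cast hn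
  have h0 : ∀ i, 0 ≤ ξ i := fun i => le_trans (by positivity) (hξ.1 i)
  constructor
  · calc (1 / 2 : ℝ) = ∑ _i : Fin n, 1 / 2 * (1 / (n : ℝ)) := by
          rw [Finset.sum_const, Finset.card_univ, Fintype.card_fin, nsmul_eq_mul]; field_simp
      _ ≤ x ⬝ᵥ ξ := Finset.sum_le_sum fun i _ =>
          mul_le_mul (hx i).1 (hξ.1 i) (by positivity) (by linarith [(hx i).1])
  · calc x ⬝ᵥ ξ ≤ ∑ _i : Fin n, 1 * (3 / (2 * (n : ℝ))) := Finset.sum_le_sum fun i _ =>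
          mul_le_mul (hx i).2 (hξ.2 i) (h0 i) zero_le_one
      _ = 3 / 2 := by
          rw [Finset.sum_const, Finset.card_univ, Fintype.card_fin, nsmul_eq_mul]; field_simp

end LowerBound

section LowerBound

variable {m : ℕ} {d : Fin m → ℕ} {α : ℝ} {E : (j : Fin m) → Matrix (Fin (d j)) (Fin (d j)) ℝ}
  {H : Fin m → ℝ} {ψ : (j : Fin m) → (Fin (d j) → ℝ) → ℝ}

/-- The oscillating part of the kernel in the blocks other than the first. -/
def tailPhase [NeZero m] (x ξ : Space d) : ℂ :=
  ∏ j ∈ Finset.univ.erase 0, (Complex.exp (Complex.I * ((x j ⬝ᵥ ξ j : ℝ) : ℂ)) - 1)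

theorem norm_kernel_sub_kernel [NeZero m] (hψ : ∀ j, IsHomogeneous (E j)ᵀ (ψ j)) (x y ξ : Space d) :
    ‖kernel α E H ψ x ξ - kernel α E H ψ y ξ‖ =
      ‖(Complex.exp (Complex.I * ((x 0 ⬝ᵥ ξ 0 : ℝ) : ℂ)) - 1) * tailPhase x ξ -
        (Complex.exp (Complex.I * ((y 0 ⬝ᵥ ξ 0 : ℝ) : ℂ)) - 1) * tailPhase y ξ‖ *
      (ψ 0 (ξ 0) ^ (-H 0 - (E 0).trace / α) *
        ∏ j ∈ Finset.univ.erase 0, ψ j (ξ j) ^ (-H j - (E j).trace / α)) := by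
  have h : ∀ z : Space d, kernel α E H ψ z ξ =
      (Complex.exp (Complex.I * ((z 0 ⬝ᵥ ξ 0 : ℝ) : ℂ)) - 1) * tailPhase z ξ *
        ((∏ j, ψ j (ξ j) ^ (-H j - (E j).trace / α) : ℝ) : ℂ) := by
    intro z
    rw [kernel, Finset.prod_mul_distrib, tailPhase, Finset.mul_prod_erase _
      (fun j => Complex.exp (Complex.I * ((z j ⬝ᵥ ξ j : ℝ) : ℂ)) - 1) (Finset.mem_univ 0),
      Complex.ofReal_prod]
  rw [h, h, ← sub_mul, norm_mul, Complex.norm_real, Real.norm_of_nonneg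
    (Finset.prod_nonneg fun j _ => Real.rpow_nonneg ((hψ j).nonneg _) _),
    Finset.mul_prod_erase _ (fun j => ψ j (ξ j) ^ (-H j - (E j).trace / α)) (Finset.mem_univ 0)]

/-- The reflection of the first block. -/
def reflect [NeZero m] (ξ : Space d) : Space d := fun j => if j = 0 then -ξ j else ξ j

theorem measurePreserving_reflect [NeZero m] :
    MeasurePreserving (reflect : Space d → Space d) volume volume := by
  refine measurePreserving_pi (fun _ => volume) (fun _ => volume)
    (f := fun j (v : Fin (d j) → ℝ) => if j = 0 then -v else v) fun j => ?_
  by_cases hj : j = 0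
  · simpa only [hj, if_true] using Measure.measurePreserving_neg _
  · simp only [hj, if_false]
    exact MeasurePreserving.id _

theorem tailPhase_reflect [NeZero m] (x ξ : Space d) : tailPhase x (reflect ξ) = tailPhase x ξ := by
  refine Finset.prod_congr rfl fun j hj => ?_
  rw [reflect, if_neg (Finset.ne_of_mem_erase hj)]

/-- The region of frequencies used for the blocks other than the first. -/
def box (d : Fin m → ℕ) (j : Fin m) : Set (Fin (d j) → ℝ) :=
  Icc (fun _ => 1 / (d j : ℝ)) (fun _ => 3 / (2 * (d j : ℝ)))

theorem volume_real_box_pos (hd : ∀ j, 0 < d j) (j : Fin m) : 0 < volume.real (box d j) := by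
  have hj : (0 : ℝ) < d j := by exact_mod_cast hd j
  have hlt : 1 / (d j : ℝ) < 3 / (2 * (d j : ℝ)) := by
    rw [div_lt_div_iff₀ hj (by positivity)]; linarith
  rw [Measure.real, box, Real.volume_Icc_pi, ENNReal.toReal_prod]
  refine Finset.prod_pos fun i _ => ?_
  rw [ENNReal.toReal_ofReal (by linarith)]
  linarith

theorem norm_tailPhase_le [NeZero m] (x ξ : Space d) :
    ‖tailPhase x ξ‖ ≤ ∏ _j ∈ Finset.univ.erase (0 : Fin m), (2 : ℝ) := by
  rw [tailPhase, norm_prod]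
  exact Finset.prod_le_prod (fun _ _ => norm_nonneg _) fun j _ => norm_exp_I_mul_sub_one_le_two _

theorem le_norm_tailPhase [NeZero m] (hd : ∀ j, 0 < d j) {x ξ : Space d} (hx : x ∈ cube d)
    (hξ : ∀ j ≠ 0, ξ j ∈ box d j) :
    ∏ _j ∈ Finset.univ.erase (0 : Fin m), (1 / 4 : ℝ) ≤ ‖tailPhase x ξ‖ := by
  rw [tailPhase, norm_prod]
  refine Finset.prod_le_prod (fun _ _ => by norm_num) fun j hj => ?_
  obtain ⟨h1, h2⟩ := dotProduct_mem_of_mem_Icc (hd j) (hx j) (hξ j (Finset.ne_of_mem_erase hj))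
  exact quarter_le_norm_exp_sub_one h1 h2

/-- Lower bound for the increments of the kernel in `L^α`, in terms of the `E₀`-homogeneous size
`exp (-t)` of the increment in the first block. -/
theorem exists_le_integral_norm_kernel_sub [NeZero m] (hd : ∀ j, 0 < d j) (hα : 0 < α)
    (hψ : ∀ j, IsHomogeneous (E j)ᵀ (ψ j))
    (hk : ∀ x, MemLp (kernel α E H ψ x) (ENNReal.ofReal α) volume) :
    ∃ c : ℝ, 0 < c ∧ ∀ x ∈ cube d, ∀ y ∈ cube d, ∀ t : ℝ, ‖exp (t • E 0) *ᵥ (x 0 - y 0)‖ = 1 →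
      c * Real.exp (-(t * H 0)) ^ α ≤
        ∫ ξ, ‖kernel α E H ψ x ξ - kernel α E H ψ y ξ‖ ^ α := by
  set β : Fin m → ℝ := fun j => -H j - (E j).trace / α with hβ
  have hbox : ∀ j, ∃ c : ℝ, 0 < c ∧ ∀ ξ ∈ box d j, c ≤ ψ j ξ ^ β j := fun j =>
    (hψ j).exists_pos_le_rpow (β j) isCompact_Icc fun h => by
      have hj : (0 : ℝ) < d j := by exact_mod_cast hd j
      have h1 : 1 / (d j : ℝ) ≤ 0 := h.1 ⟨0, hd j⟩
      have : 0 < 1 / (d j : ℝ) := by positivity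
      linarith
  choose cb hcb0 hcb using hbox
  obtain ⟨ca, hca0, hca⟩ := (hψ 0).exists_pos_le_rpow (β 0)
    (K := {η | 1 / 2 ≤ ‖η‖ ∧ ‖η‖ ≤ 3 / 2}) (by
      refine Metric.isCompact_of_isClosed_isBounded ?_ ?_
      · exact (isClosed_le continuous_const continuous_norm).inter
          (isClosed_le continuous_norm continuous_const)
      · refine (Metric.isBounded_closedBall (x := 0) (r := 3 / 2)).subset fun η hη => ?_
        simpa using hη.2) (by simp)
  set q₀ : ℝ := ∏ _j ∈ Finset.univ.erase (0 : Fin m), (1 / 4 : ℝ) with hq₀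
  set C₀ : ℝ := ∏ _j ∈ Finset.univ.erase (0 : Fin m), (2 : ℝ) with hC₀
  have hq₀p : 0 < q₀ := Finset.prod_pos fun _ _ => by norm_num
  have hC₀p : 0 < C₀ := Finset.prod_pos fun _ _ => by norm_num
  set cB : ℝ := ∏ j ∈ Finset.univ.erase 0, cb j with hcB
  have hcBp : 0 < cB := Finset.prod_pos fun j _ => hcb0 j
  set c₁ : ℝ := q₀ * q₀ / 32 / (2 * C₀) * (ca * cB) with hc₁
  have hc₁p : 0 < c₁ := by positivity
  set vB : ℝ := ∏ j ∈ Finset.univ.erase 0, volume.real (box d j) with hvB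
  have hvBp : 0 < vB := Finset.prod_pos fun j _ => volume_real_box_pos hd j
  have hd0 : (0 : ℝ) < d 0 := by exact_mod_cast hd 0
  set v₀ : ℝ := (2 * (1 / (2 * (d 0 : ℝ)))) ^ (d 0) with hv₀
  have hv₀p : 0 < v₀ := by positivity
  refine ⟨c₁ ^ α * (v₀ * vB) / 2, by positivity, fun x hx y hy t ht => ?_⟩
  set l := exp (t • E 0) *ᵥ (x 0 - y 0) with hl
  set f : Space d → ℝ := fun ξ => ‖kernel α E H ψ x ξ - kernel α E H ψ y ξ‖ ^ α with hf
  have hfint : Integrable f := by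
    have h := (hk x).sub (hk y)
    have := (integrable_norm_rpow_iff h.1 (by simpa using hα) (by simp)).2 h
    rwa [ENNReal.toReal_ofReal hα.le] at this
  have hf0 : ∀ ξ, 0 ≤ f ξ := fun ξ => by positivity
  set Φ : (Fin (d 0) → ℝ) → (Fin (d 0) → ℝ) := fun ξ => exp ((-t) • (E 0)ᵀ) *ᵥ ξ with hΦ
  have hΦl : ∀ ξ : Fin (d 0) → ℝ, (x 0 - y 0) ⬝ᵥ ξ = l ⬝ᵥ Φ ξ := by
    intro ξ
    have h1 : x 0 - y 0 = exp ((-t) • E 0) *ᵥ l := (exp_neg_smul_mulVec_exp_smul (E 0) t _).symm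
    rw [h1, hΦ, dotProduct_mulVec]
    congr 1
    rw [← transpose_smul, Matrix.exp_transpose, vecMul_transpose]
  have hψΦ : ∀ ξ, ψ 0 ξ ^ β 0 = Real.exp (t * β 0) * ψ 0 (Φ ξ) ^ β 0 := by
    intro ξ
    simp only [hΦ, (hψ 0).map_exp_smul_mulVec]
    rw [Real.mul_rpow (Real.exp_pos _).le ((hψ 0).nonneg _), ← Real.exp_mul, ← mul_assoc,
      ← Real.exp_add, neg_mul, add_neg_cancel, Real.exp_zero, one_mul]
  have hpt : ∀ ξ : Space d, (∀ j ≠ 0, ξ j ∈ box d j) → 1 / 2 ≤ ‖Φ (ξ 0)‖ → ‖Φ (ξ 0)‖ ≤ 3 / 2 →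
      ‖tailPhase x ξ * starRingEnd ℂ (tailPhase y ξ)‖ / 32 ≤
        |(tailPhase x ξ * starRingEnd ℂ (tailPhase y ξ) *
          (1 - Complex.exp (Complex.I * ((l ⬝ᵥ Φ (ξ 0) : ℝ) : ℂ)))).re| →
      (c₁ * Real.exp (t * β 0)) ^ α ≤ f ξ := by
    intro ξ hξ h1 h2 h3
    refine Real.rpow_le_rpow (by positivity) ?_ hα.le
    rw [norm_kernel_sub_kernel hψ]
    have hw : q₀ * q₀ ≤ ‖tailPhase x ξ * starRingEnd ℂ (tailPhase y ξ)‖ := by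
      rw [norm_mul, RCLike.norm_conj]
      exact mul_le_mul (le_norm_tailPhase hd hx hξ) (le_norm_tailPhase hd hy hξ) hq₀p.le
        (norm_nonneg _)
    have h4 := abs_re_mul_one_sub_exp_le (norm_tailPhase_le x ξ) (norm_tailPhase_le y ξ)
      (x 0 ⬝ᵥ ξ 0) (y 0 ⬝ᵥ ξ 0)
    rw [← sub_dotProduct, hΦl] at h4
    have h5 : q₀ * q₀ / 32 / (2 * C₀) ≤
        ‖(Complex.exp (Complex.I * ((x 0 ⬝ᵥ ξ 0 : ℝ) : ℂ)) - 1) * tailPhase x ξ -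
        (Complex.exp (Complex.I * ((y 0 ⬝ᵥ ξ 0 : ℝ) : ℂ)) - 1) * tailPhase y ξ‖ := by
      rw [div_le_iff₀ (by positivity), mul_comm _ (2 * C₀)]
      linarith
    have h6 : ca * Real.exp (t * β 0) ≤ ψ 0 (ξ 0) ^ β 0 := by
      rw [hψΦ, mul_comm]
      exact mul_le_mul_of_nonneg_left (hca _ ⟨h1, h2⟩) (Real.exp_pos _).le
    have h7 : cB ≤ ∏ j ∈ Finset.univ.erase 0, ψ j (ξ j) ^ β j :=
      Finset.prod_le_prod (fun j _ => (hcb0 j).le) fun j hj =>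
        hcb j _ (hξ j (Finset.ne_of_mem_erase hj))
    calc c₁ * Real.exp (t * β 0)
        = q₀ * q₀ / 32 / (2 * C₀) * (ca * Real.exp (t * β 0) * cB) := by rw [hc₁]; ring
      _ ≤ _ := mul_le_mul h5 (mul_le_mul h6 h7 hcBp.le (Real.rpow_nonneg ((hψ 0).nonneg _) _))
          (by positivity) (norm_nonneg _)
  obtain ⟨v, hv⟩ := exists_closedBall_dotProduct_mem (hd 0) ht
  set S : Set (Space d) := univ.pi (Function.update (box d) 0
    (Φ ⁻¹' Metric.closedBall v (1 / (2 * (d 0 : ℝ))))) with hS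
  have hΦc : Continuous Φ := by fun_prop
  have hSm : MeasurableSet S := by
    refine MeasurableSet.univ_pi fun j => ?_
    by_cases hj : j = 0
    · subst hj
      rw [Function.update_self]
      exact hΦc.measurable Metric.isClosed_closedBall.measurableSet
    · rw [Function.update_of_ne hj]
      exact measurableSet_Icc
  have hSv : volume.real S = Real.exp (t * (E 0).trace) * v₀ * vB := by
    rw [Measure.real, hS, volume_pi_pi, ENNReal.toReal_prod,
      ← Finset.mul_prod_erase _ _ (Finset.mem_univ 0), Function.update_self]
    congr 1
    · rw [hΦ, volume_preimage_exp_smul, Real.volume_pi_closedBall _ (by positivity),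
        ENNReal.toReal_mul, ENNReal.toReal_ofReal (Real.exp_pos _).le,
        ENNReal.toReal_ofReal (by positivity), trace_transpose, neg_mul, neg_neg, Fintype.card_fin]
    · refine Finset.prod_congr rfl fun j hj => ?_
      rw [Function.update_of_ne (Finset.ne_of_mem_erase hj)]
      rfl
  have hSfin : volume S ≠ ⊤ := by
    intro h
    rw [Measure.real, h, ENNReal.toReal_top] at hSv
    have : 0 < Real.exp (t * (E 0).trace) * v₀ * vB := by positivity
    linarith
  have hsum : ∀ ξ ∈ S, (c₁ * Real.exp (t * β 0)) ^ α ≤ f ξ + f (reflect ξ) := by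
    intro ξ hξ
    have hξb : ∀ j ≠ 0, ξ j ∈ box d j := fun j hj => by
      have := hξ j (mem_univ j)
      rwa [Function.update_of_ne hj] at this
    have hξ0 : Φ (ξ 0) ∈ Metric.closedBall v (1 / (2 * (d 0 : ℝ))) := by
      have := hξ 0 (mem_univ 0)
      rwa [Function.update_self] at this
    obtain ⟨h1, h2, h3, h4⟩ := hv _ hξ0
    obtain ⟨e, he, hew⟩ := exists_sign_le_abs_re (tailPhase x ξ * starRingEnd ℂ (tailPhase y ξ))
    rcases (abs_eq zero_le_one).1 he with rfl | rfl
    · have := hpt ξ hξb h3 h4 (hew _ (by linarith) (by linarith))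
      linarith [hf0 (reflect ξ)]
    · have hr0 : Φ (reflect ξ 0) = -Φ (ξ 0) := by
        simp only [hΦ, reflect, if_true, mulVec_neg]
      have := hpt (reflect ξ) (fun j hj => by rw [reflect, if_neg hj]; exact hξb j hj)
        (by rwa [hr0, norm_neg]) (by rwa [hr0, norm_neg]) (by
          rw [tailPhase_reflect, tailPhase_reflect, hr0, dotProduct_neg]
          exact hew _ (by linarith) (by linarith))
      linarith [hf0 ξ]
  have hrint : Integrable fun ξ => f (reflect ξ) :=
    measurePreserving_reflect.integrable_comp_of_integrable hfint
  have hreq : ∫ ξ, f (reflect ξ) = ∫ ξ, f ξ := by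
    have := integral_map (φ := (reflect : Space d → Space d)) (μ := volume) (f := f)
      measurePreserving_reflect.aemeasurable
      (by rw [measurePreserving_reflect.map_eq]; exact hfint.1)
    rw [measurePreserving_reflect.map_eq] at this
    exact this.symm
  have hfin := (setIntegral_ge_of_const_le_real hSm hSfin hsum
    (hfint.add hrint).integrableOn).trans
    (setIntegral_le_integral (hfint.add hrint)
      (Filter.Eventually.of_forall fun ξ => add_nonneg (hf0 ξ) (hf0 _)))
  rw [integral_add hfint hrint, hreq, hSv] at hfin
  have hexp : (c₁ * Real.exp (t * β 0)) ^ α * (Real.exp (t * (E 0).trace) * v₀ * vB) =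
      c₁ ^ α * (v₀ * vB) * Real.exp (-(t * H 0)) ^ α := by
    rw [Real.mul_rpow hc₁p.le (Real.exp_pos _).le, ← Real.exp_mul, ← Real.exp_mul]
    have : Real.exp (-(t * H 0) * α) = Real.exp (t * β 0 * α) * Real.exp (t * (E 0).trace) := by
      rw [← Real.exp_add]
      congr 1
      simp only [hβ]
      field_simp
      ring
    rw [this]; ring
  rw [hexp] at hfin
  linarith

end LowerBound

section SingularIntegral

open scoped ENNReal

/-- Tonelli's theorem for a product of functions of one block each. -/
theorem lintegral_fin_prod : ∀ {n : ℕ} {X : Fin n → Type} [∀ i, MeasureSpace (X i)]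
    [∀ i, SigmaFinite (volume : Measure (X i))] {f : ∀ i, X i → ℝ≥0∞},
    (∀ i, Measurable (f i)) → ∫⁻ x : ∀ i, X i, ∏ i, f i (x i) = ∏ i, ∫⁻ x, f i x
  | 0, X, _, _, f, _ => by
    simp only [Finset.univ_eq_empty, Finset.prod_empty, lintegral_const, one_mul]
    rw [volume_pi, Measure.pi_of_empty, Measure.dirac_apply_of_mem (mem_univ _)]
  | n + 1, X, _, _, f, hf => by
    have hp := (measurePreserving_piFinSuccAbove (fun i : Fin (n + 1) =>
      (volume : Measure (X i))) 0).symm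
    rw [volume_pi, ← hp.lintegral_comp_emb (MeasurableEquiv.measurableEmbedding _)]
    simp only [Fin.prod_univ_succ]
    rw [← lintegral_fin_prod (X := fun i => X (Fin.succ i)) fun i => hf i.succ, volume_pi]
    rw [← lintegral_prod_mul (hf 0).aemeasurable
      (Finset.measurable_fun_prod _ fun i _ => (hf i.succ).comp (measurable_pi_apply i)).aemeasurable]
    rfl

theorem lintegral_inv_abs_rpow_le {s r : ℝ} (hs : s < 1) (hr : 0 < r) :
    ∫⁻ w : ℝ, (Icc (-r) r).indicator (fun w => (ENNReal.ofReal (|w| ^ s))⁻¹) w ≤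
      ENNReal.ofReal (2 * (r ^ (1 - s) / (1 - s))) := by
  have h1s : 0 < 1 - s := sub_pos.2 hs
  set g : ℝ → ℝ≥0∞ := (Ioc 0 r).indicator fun w => (ENNReal.ofReal (|w| ^ s))⁻¹ with hg
  have hgm : Measurable g := Measurable.indicator (by fun_prop) measurableSet_Ioc
  have hpos : ∫⁻ w, g w = ENNReal.ofReal (r ^ (1 - s) / (1 - s)) := by
    have hi : IntegrableOn (fun w : ℝ => w ^ (-s)) (Ioc 0 r) :=
      (intervalIntegrable_iff_integrableOn_Ioc_of_le hr.le).1
        (intervalIntegral.intervalIntegrable_rpow' (by linarith))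
    have hv : ∫ w in Ioc 0 r, w ^ (-s) = r ^ (1 - s) / (1 - s) := by
      rw [← intervalIntegral.integral_of_le hr.le, integral_rpow (Or.inl (by linarith))]
      rw [neg_add_eq_sub, Real.zero_rpow h1s.ne', sub_zero]
    rw [hg, lintegral_indicator measurableSet_Ioc, ← hv, ofReal_integral_eq_lintegral_ofReal hi
      ((ae_restrict_iff' measurableSet_Ioc).2 (Filter.Eventually.of_forall fun w hw =>
        Real.rpow_nonneg hw.1.le _))]
    refine setLIntegral_congr_fun measurableSet_Ioc fun w hw => ?_
    rw [abs_of_pos hw.1, Real.rpow_neg hw.1.le, ENNReal.ofReal_inv_of_pos (Real.rpow_pos_of_pos hw.1 _)]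
  have hneg : ∫⁻ w, g (-w) = ∫⁻ w, g w := lintegral_neg_eq_self g
  calc ∫⁻ w : ℝ, (Icc (-r) r).indicator (fun w => (ENNReal.ofReal (|w| ^ s))⁻¹) w
      ≤ ∫⁻ w : ℝ, (g w + g (-w)) := by
        refine lintegral_mono_ae ?_
        have h0 : ∀ᵐ w : ℝ, w ≠ 0 := Measure.ae_ne volume 0
        filter_upwards [h0] with w hw
        by_cases hmem : w ∈ Icc (-r) r
        · rw [indicator_of_mem hmem]
          rcases lt_or_gt_of_ne hw with h | h
          · refine le_add_of_nonneg_of_le zero_le (le_of_eq ?_)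
            rw [hg, indicator_of_mem (show -w ∈ Ioc 0 r from ⟨by linarith, by linarith [hmem.1]⟩),
              abs_neg]
          · refine le_add_of_le_of_nonneg (le_of_eq ?_) zero_le
            rw [hg, indicator_of_mem (show w ∈ Ioc 0 r from ⟨h, hmem.2⟩)]
        · rw [indicator_of_notMem hmem]
          exact zero_le
    _ = ENNReal.ofReal (2 * (r ^ (1 - s) / (1 - s))) := by
        rw [lintegral_add_left hgm, hneg, hpos, ← ENNReal.ofReal_add (by positivity) (by positivity),
          ← two_mul]

/-- The singularity `|⟨u, z⟩| ^ (-s)`, `s < 1`, on balls. -/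
theorem exists_lintegral_inv_abs_dotProduct_rpow_le {n : ℕ} {u : Fin n → ℝ} (hu : u ≠ 0) {s : ℝ}
    (hs : s < 1) : ∃ C : ℝ, 0 ≤ C ∧ ∀ ρ : ℝ, 0 < ρ →
      ∫⁻ z : Fin n → ℝ, (Metric.closedBall 0 ρ).indicator
        (fun z => (ENNReal.ofReal (|u ⬝ᵥ z| ^ s))⁻¹) z ≤ ENNReal.ofReal (C * ρ ^ (n - s)) := by
  obtain ⟨i, hi⟩ := Function.ne_iff.1 hu
  have hi' : u i ≠ 0 := hi
  have h1s : 0 < 1 - s := sub_pos.2 hs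
  have hn : 1 ≤ n := Nat.one_le_iff_ne_zero.2 fun h => (h ▸ i).elim0
  set L : ℝ := n * ‖u‖ with hL
  have hL0 : 0 < L := mul_pos (by exact_mod_cast hn) (norm_pos_iff.2 hu)
  refine ⟨|(u i)⁻¹| * (2 ^ (n - 1) * (2 * (L ^ (1 - s) / (1 - s)))), by positivity,
    fun ρ hρ => ?_⟩
  set M : Matrix (Fin n) (Fin n) ℝ := (1 : Matrix (Fin n) (Fin n) ℝ).updateRow i u with hM
  have hdet : M.det = u i := by
    rw [hM, ← cramer_transpose_apply, transpose_one, cramer_one]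
    rfl
  have hTi : ∀ z, (Matrix.toLin' M z) i = u ⬝ᵥ z := fun z => by
    rw [Matrix.toLin'_apply, mulVec, hM, updateRow_self]
  have hTk : ∀ z, ∀ k ≠ i, (Matrix.toLin' M z) k = z k := fun z k hk => by
    rw [Matrix.toLin'_apply, mulVec, hM, updateRow_ne hk, ← mulVec, one_mulVec]
  set g : Fin n → ℝ → ℝ≥0∞ := fun k => if k = i then
      (Icc (-(L * ρ)) (L * ρ)).indicator fun w => (ENNReal.ofReal (|w| ^ s))⁻¹
    else (Icc (-ρ) ρ).indicator fun _ => 1 with hg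
  have hgm : ∀ k, Measurable (g k) := by
    intro k
    by_cases hk : k = i
    · simp only [hg, hk, if_true]
      exact Measurable.indicator (by fun_prop) measurableSet_Icc
    · simp only [hg, hk, if_false]
      exact measurable_const.indicator measurableSet_Icc
  have hprod : ∀ z : Fin n → ℝ, (Metric.closedBall 0 ρ).indicator
      (fun z => (ENNReal.ofReal (|u ⬝ᵥ z| ^ s))⁻¹) z ≤ ∏ k, g k (Matrix.toLin' M z k) := by
    intro z
    by_cases hz : z ∈ Metric.closedBall 0 ρ
    · rw [indicator_of_mem hz]
      rw [mem_closedBall_zero_iff] at hz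
      rw [← Finset.mul_prod_erase _ _ (Finset.mem_univ i), Finset.prod_eq_one, mul_one, hTi]
      · simp only [hg, if_true]
        rw [indicator_of_mem]
        rw [mem_Icc, ← abs_le]
        exact (abs_dotProduct_le u z).trans (mul_le_mul_of_nonneg_left hz hL0.le)
      · intro k hk
        have hk' := Finset.ne_of_mem_erase hk
        rw [hTk z k hk']
        simp only [hg, hk', if_false]
        rw [indicator_of_mem]
        rw [mem_Icc, ← abs_le]
        exact (norm_le_pi_norm z k).trans hz
    · rw [indicator_of_notMem hz]
      exact zero_le
  have hgk : ∀ k ≠ i, ∫⁻ w, g k w = ENNReal.ofReal (2 * ρ) := by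
    intro k hk
    simp only [hg, hk, if_false]
    rw [lintegral_indicator_const measurableSet_Icc, one_mul, Real.volume_Icc]
    congr 1; ring
  have hgi : ∫⁻ w, g i w ≤ ENNReal.ofReal (2 * ((L * ρ) ^ (1 - s) / (1 - s))) := by
    simp only [hg, if_true]
    exact lintegral_inv_abs_rpow_le hs (by positivity)
  calc _ ≤ ∫⁻ z, ∏ k, g k (Matrix.toLin' M z k) := lintegral_mono hprod
    _ = ∫⁻ w, ∏ k, g k (w k) ∂(Measure.map (Matrix.toLin' M) volume) := by
        have hpm : Measurable fun w : Fin n → ℝ => ∏ k, g k (w k) :=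
          Finset.measurable_fun_prod _ fun k _ => (hgm k).comp (measurable_pi_apply k)
        exact (lintegral_map hpm (LinearMap.continuous_of_finiteDimensional _).measurable).symm
    _ = ENNReal.ofReal |(u i)⁻¹| * ∏ k, ∫⁻ w, g k w := by
        rw [Real.map_matrix_volume_pi_eq_smul_volume_pi (by rwa [hdet]), lintegral_smul_measure,
          hdet, lintegral_fin_prod hgm, smul_eq_mul]
    _ ≤ ENNReal.ofReal |(u i)⁻¹| * (ENNReal.ofReal (2 * ((L * ρ) ^ (1 - s) / (1 - s))) *
          ENNReal.ofReal (2 * ρ) ^ (n - 1)) := by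
        refine mul_le_mul' le_rfl ?_
        rw [← Finset.mul_prod_erase _ _ (Finset.mem_univ i)]
        refine mul_le_mul' hgi (le_of_eq ?_)
        rw [Finset.prod_congr rfl fun k hk => hgk k (Finset.ne_of_mem_erase hk), Finset.prod_const,
          Finset.card_erase_of_mem (Finset.mem_univ i), Finset.card_univ, Fintype.card_fin]
    _ = _ := by
        rw [← ENNReal.ofReal_pow (by positivity), ← ENNReal.ofReal_mul (by positivity),
          ← ENNReal.ofReal_mul (by positivity)]
        congr 1
        have : ρ ^ ((n : ℝ) - s) = ρ ^ (n - 1) * ρ ^ (1 - s) := by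
          rw [← Real.rpow_natCast, ← Real.rpow_add hρ, Nat.cast_sub hn]
          congr 1; push_cast; ring
        rw [this, Real.mul_rpow hL0.le hρ.le, mul_pow]
        ring

variable {m : ℕ} {d : Fin m → ℕ}

theorem exists_lintegral_block_le [NeZero m] {u : Fin (d 0) → ℝ} (hu : u ≠ 0) {s : ℝ}
    (hs : s < 1) : ∃ C : ℝ, 0 ≤ C ∧ ∀ ρ : ℝ, 0 < ρ →
      ∫⁻ z : Space d, (Metric.closedBall 0 ρ).indicator
        (fun z => (ENNReal.ofReal (|u ⬝ᵥ z 0| ^ s))⁻¹) z ≤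
          ENNReal.ofReal (C * ρ ^ (((∑ j, d j : ℕ) : ℝ) - s)) := by
  obtain ⟨C, hC0, hC⟩ := exists_lintegral_inv_abs_dotProduct_rpow_le hu hs
  set D' : ℕ := ∑ j ∈ Finset.univ.erase 0, d j with hD'
  refine ⟨C * 2 ^ D', by positivity, fun ρ hρ => ?_⟩
  set g₀ : (Fin (d 0) → ℝ) → ℝ≥0∞ := (Metric.closedBall 0 ρ).indicator
    (fun z => (ENNReal.ofReal (|u ⬝ᵥ z| ^ s))⁻¹) with hg₀
  set g : ∀ j, (Fin (d j) → ℝ) → ℝ≥0∞ :=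
    Function.update (fun j => (Metric.closedBall 0 ρ).indicator fun _ => 1) 0 g₀ with hg
  have hgm : ∀ j, Measurable (g j) := by
    intro j
    by_cases hj : j = 0
    · subst hj
      rw [hg, Function.update_self]
      refine Measurable.indicator ?_ Metric.isClosed_closedBall.measurableSet
      have : Measurable fun z : Fin (d 0) → ℝ => u ⬝ᵥ z :=
        Continuous.measurable (by simp only [dotProduct]; fun_prop)
      fun_prop
    · rw [hg, Function.update_of_ne hj]
      exact measurable_const.indicator Metric.isClosed_closedBall.measurableSet
  have hprod : ∀ z : Space d, (Metric.closedBall 0 ρ).indicator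
      (fun z => (ENNReal.ofReal (|u ⬝ᵥ z 0| ^ s))⁻¹) z ≤ ∏ j, g j (z j) := by
    intro z
    by_cases hz : z ∈ Metric.closedBall 0 ρ
    · have hzj : ∀ j, z j ∈ Metric.closedBall 0 ρ := fun j => by
        rw [mem_closedBall_zero_iff] at hz ⊢
        exact (norm_le_pi_norm z j).trans hz
      rw [indicator_of_mem hz, ← Finset.mul_prod_erase _ _ (Finset.mem_univ 0),
        Finset.prod_eq_one, mul_one, hg, Function.update_self, hg₀, indicator_of_mem (hzj 0)]
      intro j hj
      rw [hg, Function.update_of_ne (Finset.ne_of_mem_erase hj), indicator_of_mem (hzj j)]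
    · rw [indicator_of_notMem hz]
      exact zero_le
  refine (lintegral_mono hprod).trans ?_
  rw [lintegral_fin_prod hgm, ← Finset.mul_prod_erase _ _ (Finset.mem_univ 0)]
  have h0 : ∫⁻ z, g 0 z ≤ ENNReal.ofReal (C * ρ ^ ((d 0 : ℝ) - s)) := by
    rw [hg, Function.update_self]
    exact hC ρ hρ
  have hj : ∏ j ∈ Finset.univ.erase 0, ∫⁻ z, g j z = ENNReal.ofReal ((2 * ρ) ^ D') := by
    rw [hD', ← Finset.prod_pow_eq_pow_sum, ENNReal.ofReal_prod_of_nonneg fun j _ => by positivity]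
    refine Finset.prod_congr rfl fun j hj => ?_
    rw [hg, Function.update_of_ne (Finset.ne_of_mem_erase hj),
      lintegral_indicator_const Metric.isClosed_closedBall.measurableSet, one_mul,
      Real.volume_pi_closedBall _ hρ.le, Fintype.card_fin]
  rw [hj]
  refine (mul_le_mul' h0 le_rfl).trans (le_of_eq ?_)
  rw [← ENNReal.ofReal_mul (by positivity)]
  congr 1
  have hsum : ∑ j, d j = d 0 + D' := (Finset.add_sum_erase _ _ (Finset.mem_univ 0)).symm
  rw [hsum, Nat.cast_add, show (d 0 : ℝ) + D' - s = (d 0 - s) + D' by ring, Real.rpow_add hρ,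
    Real.rpow_natCast, mul_pow]
  ring

theorem exists_norm_le_seminorm (N : Seminorm ℝ (Space d)) (hN : ∀ x, N x = 0 → x = 0) :
    ∃ K : ℝ, 0 < K ∧ ∀ x, ‖x‖ ≤ K * N x := by
  have hc : Continuous N := by
    rw [← continuousOn_univ]
    exact N.convexOn.continuousOn isOpen_univ
  rcases (Metric.sphere (0 : Space d) 1).eq_empty_or_nonempty with h | h
  · refine ⟨1, one_pos, fun x => ?_⟩
    by_cases hx : x = 0
    · simp [hx]
    · have : ‖x‖⁻¹ • x ∈ Metric.sphere (0 : Space d) 1 := by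
        rw [mem_sphere_zero_iff_norm, norm_smul, norm_inv, norm_norm,
          inv_mul_cancel₀ (norm_ne_zero_iff.2 hx)]
      simp [h] at this
  · obtain ⟨x₀, hx₀, hmin⟩ := (isCompact_sphere (0 : Space d) 1).exists_isMinOn h hc.continuousOn
    have hp : 0 < N x₀ := (apply_nonneg N x₀).lt_of_ne' fun h0 => by
      rw [hN x₀ h0] at hx₀; simp at hx₀
    refine ⟨(N x₀)⁻¹, by positivity, fun x => ?_⟩
    by_cases hx : x = 0
    · simp [hx]
    · have hx' : 0 < ‖x‖ := norm_pos_iff.2 hx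
      have hmem : ‖x‖⁻¹ • x ∈ Metric.sphere (0 : Space d) 1 := by
        rw [mem_sphere_zero_iff_norm, norm_smul, norm_inv, norm_norm, inv_mul_cancel₀ hx'.ne']
      have h1 : N x₀ ≤ N (‖x‖⁻¹ • x) := hmin hmem
      rw [map_smul_eq_mul, norm_inv, norm_norm, inv_mul_eq_div, le_div_iff₀ hx'] at h1
      rw [inv_mul_eq_div, le_div_iff₀ hp]
      linarith

theorem volume_cube_lt_top : volume (cube d) < ⊤ := by
  refine (measure_mono (t := Metric.closedBall 0 1) fun x hx => ?_).trans_lt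
    measure_closedBall_lt_top
  rw [mem_closedBall_zero_iff]
  refine (pi_norm_le_iff_of_nonneg zero_le_one).2 fun j =>
    (pi_norm_le_iff_of_nonneg zero_le_one).2 fun i => ?_
  rw [Real.norm_eq_abs, abs_le]
  constructor <;> linarith [(hx j i).1, (hx j i).2]

theorem measurableSet_cube : MeasurableSet (cube d) := by
  have : cube d = ⋂ j, ⋂ i, {x : Space d | 1 / 2 ≤ x j i ∧ x j i ≤ 1} := by
    ext x; simp [cube]
  rw [this]
  refine MeasurableSet.iInter fun j => MeasurableSet.iInter fun i => ?_
  have hm : Measurable fun x : Space d => x j i := by fun_prop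
  exact (measurableSet_le measurable_const hm).inter (measurableSet_le hm measurable_const)

instance isNegInvariant_volume_space : (volume : Measure (Space d)).IsNegInvariant :=
  Measure.pi.isNegInvariant _

/-- Integrals of a function of the increment over a dyadic shell. -/
theorem setLIntegral_dyadicShell_le [NeZero m] (N : Seminorm ℝ (Space d)) {K : ℝ}
    (hK : ∀ x, ‖x‖ ≤ K * N x) (hK0 : 0 < K) {F : Space d × Space d → ℝ≥0∞} {G : Space d → ℝ≥0∞}
    (hG : Measurable G) (hFG : ∀ x ∈ cube d, ∀ y ∈ cube d, F (x, y) ≤ G (x - y)) (l : ℕ) :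
    ∫⁻ p in dyadicShell N l, F p ≤ volume (cube d) *
      ∫⁻ z, (Metric.closedBall 0 (K * 2 ^ (-(l : ℝ)))).indicator G z := by
  set B := (Metric.closedBall (0 : Space d) (K * 2 ^ (-(l : ℝ)))).indicator G with hB
  have hBm : Measurable B := hG.indicator Metric.isClosed_closedBall.measurableSet
  set I : Space d → ℝ≥0∞ := (cube d).indicator fun _ => 1 with hI
  have hIm : Measurable I := measurable_const.indicator measurableSet_cube
  have hm : Measurable fun p : Space d × Space d => I p.1 * B (p.1 - p.2) := by fun_prop
  calc ∫⁻ p in dyadicShell N l, F p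
      ≤ ∫⁻ p in dyadicShell N l, I p.1 * B (p.1 - p.2) := by
        refine setLIntegral_mono hm fun p hp => ?_
        obtain ⟨h1, h2, -, -, h3⟩ := hp
        have hmem : p.1 - p.2 ∈ Metric.closedBall (0 : Space d) (K * 2 ^ (-(l : ℝ))) := by
          rw [mem_closedBall_zero_iff]
          exact (hK _).trans (mul_le_mul_of_nonneg_left h3 hK0.le)
        rw [hI, indicator_of_mem h1, one_mul, hB, indicator_of_mem hmem]
        exact hFG _ h1 _ h2
    _ ≤ ∫⁻ p : Space d × Space d, I p.1 * B (p.1 - p.2) := setLIntegral_le_lintegral _ _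
    _ = ∫⁻ x, I x * ∫⁻ z, B z := by
        rw [Measure.volume_eq_prod, lintegral_prod _ hm.aemeasurable]
        refine lintegral_congr fun x => ?_
        simp only
        rw [lintegral_const_mul _ (by fun_prop), lintegral_sub_left_eq_self B x]
    _ = volume (cube d) * ∫⁻ z, B z := by
        rw [lintegral_mul_const _ hIm, hI, lintegral_indicator_const measurableSet_cube, one_mul]

end SingularIntegral

section Sheet

variable {m : ℕ} {d : Fin m → ℕ} {α : ℝ} {E : (j : Fin m) → Matrix (Fin (d j)) (Fin (d j)) ℝ}
  {H : Fin m → ℝ} {ψ : (j : Fin m) → (Fin (d j) → ℝ) → ℝ}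

/-- On the cube, `σ (x, y)` dominates a power of a nonzero linear functional of `x₁ - y₁`. -/
theorem exists_functional_rpow_le_sigma [NeZero m] (hd : ∀ j, 0 < d j)
    (hE : ∀ j, ∀ r ∈ eigRe (E j), 0 < r) (hα : 0 < α)
    (hH : ∀ j, 0 < H j ∧ H j < minRe (E j)) (hψ : ∀ j, IsHomogeneous (E j)ᵀ (ψ j))
    {Ω : Type*} [MeasurableSpace Ω] {P : Measure Ω} {κ : ℝ} (hκ : 0 < κ)
    {W : (Space d → ℂ) → Ω → ℂ} (hW : IsIsotropicStableIntegral α κ volume P W) :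
    ∃ (u : Fin (d 0) → ℝ) (c : ℝ), u ≠ 0 ∧ 0 < c ∧ ∀ x ∈ cube d, ∀ y ∈ cube d,
      c * |u ⬝ᵥ (x 0 - y 0)| ^ (H 0 / maxRe (E 0)) ≤ sigma α E H ψ P W x y := by
  have hk := fun x => memLp_kernel (ψ := ψ) hE hα hH hψ x
  obtain ⟨c, hc0, hc⟩ := exists_le_integral_norm_kernel_sub hd hα hψ hk
  obtain ⟨u, C, hu, hC0, hC⟩ := exists_functional_le (hd 0) (E 0)
  have hM : 0 < maxRe (E 0) := hE 0 _ (maxRe_mem (hd 0) (E 0))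
  set s := H 0 / maxRe (E 0) with hs
  have hs0 : 0 < s := div_pos (hH 0).1 hM
  refine ⟨u, (κ * c) ^ α⁻¹ * (C ^ s)⁻¹, hu, by positivity, fun x hx y hy => ?_⟩
  rw [sigma_eq hκ hW hα hk]
  by_cases hz : x 0 - y 0 = 0
  · rw [hz, dotProduct_zero, abs_zero, Real.zero_rpow hs0.ne', mul_zero]
    exact Real.rpow_nonneg (mul_nonneg hκ.le (integral_nonneg fun ξ => by positivity)) _
  obtain ⟨t, ht⟩ := exists_norm_exp_smul_mulVec_eq_one (hE 0) hz
  have h1 : |u ⬝ᵥ (x 0 - y 0)| ^ s ≤ C ^ s * Real.exp (-(t * H 0)) := by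
    have h := hC (-t) (exp (t • E 0) *ᵥ (x 0 - y 0))
    rw [exp_neg_smul_mulVec_exp_smul, ht, mul_one] at h
    refine (Real.rpow_le_rpow (abs_nonneg _) h hs0.le).trans (le_of_eq ?_)
    rw [Real.mul_rpow hC0.le (Real.exp_pos _).le, ← Real.exp_mul]
    congr 2
    rw [hs]
    field_simp
  have h2 : (κ * c) ^ α⁻¹ * Real.exp (-(t * H 0)) ≤
      (κ * ∫ ξ, ‖kernel α E H ψ x ξ - kernel α E H ψ y ξ‖ ^ α) ^ α⁻¹ := by
    have e : (κ * c) ^ α⁻¹ * Real.exp (-(t * H 0)) =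
        (κ * (c * Real.exp (-(t * H 0)) ^ α)) ^ α⁻¹ := by
      rw [← mul_assoc, Real.mul_rpow (x := κ * c) (by positivity) (by positivity),
        Real.rpow_rpow_inv (Real.exp_pos _).le hα.ne']
    rw [e]
    exact Real.rpow_le_rpow (by positivity)
      (mul_le_mul_of_nonneg_left (hc x hx y hy t ht) hκ.le) (by positivity)
  refine le_trans ?_ h2
  rw [mul_assoc]
  refine mul_le_mul_of_nonneg_left ?_ (by positivity)
  rw [inv_mul_le_iff₀ (by positivity)]
  exact h1

theorem tsum_ofReal_mul_geometric_lt_top {a q : ℝ} (ha : 0 ≤ a) (hq0 : 0 ≤ q) (hq : q < 1) :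
    ∑' l : ℕ, ENNReal.ofReal (a * q ^ l) < ⊤ := by
  rw [← ENNReal.ofReal_tsum_of_nonneg (fun l => by positivity)
    ((summable_geometric_of_lt_one hq0 hq).mul_left a)]
  exact ENNReal.ofReal_lt_top

end Sheet

end StableSheet

end

theorem proposition4p2
    {m : ℕ} [NeZero m] (d : Fin m → ℕ) (hd : ∀ j, 0 < d j)
    -- the matrices, with eigenvalues of positive real part
    (E : (j : Fin m) → Matrix (Fin (d j)) (Fin (d j)) ℝ)
    (hE : ∀ j, ∀ r ∈ StableSheet.eigRe (E j), 0 < r)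
    -- the index of stability, the exponents and the homogeneous functions
    (α : ℝ) (hα : 0 < α) (hα2 : α ≤ 2)
    (H : Fin m → ℝ) (hH : ∀ j, 0 < H j ∧ H j < StableSheet.minRe (E j))
    (ψ : (j : Fin m) → (Fin (d j) → ℝ) → ℝ)
    (hψ : ∀ j, StableSheet.IsHomogeneous (E j).transpose (ψ j))
    -- the first block attains the minimum of `H_j / a_{p_j}^j`
    (hmin : ∀ j, H 0 / StableSheet.maxRe (E 0) ≤ H j / StableSheet.maxRe (E j))
    -- the stochastic integral with Lebesgue control measure
    {Ω : Type*} [MeasurableSpace Ω] (P : MeasureTheory.Measure Ω)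
    [MeasureTheory.IsProbabilityMeasure P]
    (κ : ℝ) (hκ : 0 < κ) (W : (StableSheet.Space d → ℂ) → Ω → ℂ)
    (hW : StableSheet.IsIsotropicStableIntegral α κ MeasureTheory.volume P W)
    -- an arbitrary norm on `ℝ^d`
    (N : Seminorm ℝ (StableSheet.Space d)) (hN : ∀ x, N x = 0 → x = 0) :
    ∃ ε₀ : ℝ, 0 < ε₀ ∧ ∀ ε : ℝ, 0 < ε → ε < ε₀ → ∀ γ : ℝ, 1 < γ →
      γ < ((∑ j, d j : ℕ) : ℝ) + 1 - H 0 / StableSheet.maxRe (E 0) - ε →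
      ∑' l : ℕ, ENNReal.ofReal ((2 : ℝ) ^ ((l : ℝ) * (γ - 1))) *
        ∫⁻ p in StableSheet.dyadicShell N l,
          (ENNReal.ofReal (StableSheet.sigma α E H ψ P W p.1 p.2))⁻¹ < ⊤ := by
  open StableSheet MeasureTheory Set in
  refine ⟨1, one_pos, fun ε hε _ γ _ hγ => ?_⟩
  obtain ⟨u, c, hu, hc0, hc⟩ := exists_functional_rpow_le_sigma hd hE hα hH hψ hκ hW
  obtain ⟨K, hK0, hK⟩ := exists_norm_le_seminorm N hN
  have hmem := maxRe_mem (hd 0) (E 0)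
  have hM : 0 < maxRe (E 0) := hE 0 _ hmem
  set s := H 0 / maxRe (E 0) with hs
  have hs1 : s < 1 := by
    rw [hs, div_lt_one hM]
    exact lt_of_lt_minRe (hH 0).2 _ hmem
  obtain ⟨C, hC0, hC⟩ := exists_lintegral_block_le (d := d) hu hs1
  set D : ℝ := ((∑ j, d j : ℕ) : ℝ) with hD
  have hGm : Measurable fun z : Space d => (ENNReal.ofReal (|u ⬝ᵥ z 0| ^ s))⁻¹ := by
    have : Measurable fun z : Space d => u ⬝ᵥ z 0 :=
      Continuous.measurable (by simp only [dotProduct]; fun_prop)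
    fun_prop
  have hshell : ∀ l : ℕ, ∫⁻ p in dyadicShell N l, (ENNReal.ofReal (sigma α E H ψ P W p.1 p.2))⁻¹ ≤
      volume (cube d) * (ENNReal.ofReal c)⁻¹ *
        ENNReal.ofReal (C * (K * 2 ^ (-(l : ℝ))) ^ (D - s)) := by
    intro l
    refine (setLIntegral_dyadicShell_le N hK hK0 (hGm.const_mul (ENNReal.ofReal c)⁻¹)
      (fun x hx y hy => ?_) l).trans ?_
    · rw [← ENNReal.mul_inv (Or.inl (by simpa using hc0)) (Or.inl ENNReal.ofReal_ne_top),
        ← ENNReal.ofReal_mul hc0.le]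
      exact ENNReal.inv_le_inv.2 (ENNReal.ofReal_le_ofReal (hc x hx y hy))
    · rw [mul_assoc]
      refine mul_le_mul' le_rfl ?_
      simp_rw [indicator_const_mul]
      rw [lintegral_const_mul _ (hGm.indicator Metric.isClosed_closedBall.measurableSet)]
      exact mul_le_mul' le_rfl (hC _ (by positivity))
  set q : ℝ := 2 ^ (γ - 1 - (D - s)) with hq
  have hq1 : q < 1 := Real.rpow_lt_one_of_one_lt_of_neg one_lt_two (by linarith)
  have hterm : ∀ l : ℕ, (2 : ℝ) ^ ((l : ℝ) * (γ - 1)) * (C * (K * 2 ^ (-(l : ℝ))) ^ (D - s)) =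
      C * K ^ (D - s) * q ^ l := by
    intro l
    rw [Real.mul_rpow hK0.le (by positivity), ← Real.rpow_mul zero_le_two, hq,
      ← Real.rpow_mul_natCast zero_le_two,
      show (γ - 1 - (D - s)) * (l : ℝ) = l * (γ - 1) + -(l : ℝ) * (D - s) by ring,
      Real.rpow_add two_pos]
    ring
  calc _ ≤ ∑' l : ℕ, volume (cube d) * (ENNReal.ofReal c)⁻¹ *
        ENNReal.ofReal (C * K ^ (D - s) * q ^ l) := by
        refine ENNReal.tsum_le_tsum fun l => (mul_le_mul' le_rfl (hshell l)).trans (le_of_eq ?_)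
        rw [← hterm, ENNReal.ofReal_mul (Real.rpow_nonneg zero_le_two ((l : ℝ) * (γ - 1)))]
        ring
    _ < ⊤ := by
        rw [ENNReal.tsum_mul_left]
        refine ENNReal.mul_lt_top (ENNReal.mul_lt_top volume_cube_lt_top ?_)
          (tsum_ofReal_mul_geometric_lt_top (by positivity) (by positivity) hq1)
        exact ENNReal.inv_lt_top.2 (ENNReal.ofReal_pos.2 hc0)
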